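/- Let $G=(V,E)$ be a finite connected simple graph. Place one agent at each vertex. In each round a matching of $G$ (not necessarily maximal) is chosen, and for each edge of the matching the two agents on it swap places. Two agents are acquainted once they have occupied adjacent vertices at the same time (before the first round or after some round). A strategy for acquaintance in $G$ is a finite sequence of matchings after which every two agents are acquainted, and the acquaintance time $\mathcal{AC}(G)$ is the minimal number of rounds in such a strategy. Every $n$-vertex connected graph has acquaintance time $O(n^{3/2})$, and this is tight up to a multiplicative constant. That is: 1. There is an absolute constant $C$ such that every connected graph $G$ with $n$ vertices has a strategy for acquaintance, and $\mathcal{AC}(G)\le C\,n^{3/2}$. 2. There are a constant $c>0$ and an $n_0\in\mathbb N$ such that for every $n\ge n_0$ there is a connected graph $G$ with $n$ vertices and $\mathcal{AC}(G)\ge c\,n^{3/2}$. -/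

import Mathlib

namespace Acquaintance

variable {V : Type*}

/-- `σ` is the move of agents along the matching `M` of `G`: the two agents on each edge of `M`
swap places, and all other agents stay where they are. -/
def SwapsAlong {G : SimpleGraph V} (M : G.Subgraph) (σ : Equiv.Perm V) : Prop :=
  (∀ u v, M.Adj u v → σ u = v) ∧ ∀ v, v ∉ M.verts → σ v = v

/-- A legal round: a matching of `G` (not necessarily maximal, possibly empty) is chosen and
the agents on each of its edges swap places. -/
def IsRound (G : SimpleGraph V) (σ : Equiv.Perm V) : Prop :=
  ∃ M : G.Subgraph, M.IsMatching ∧ SwapsAlong M σ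

/-- Agents are named after their initial vertices; `position σ t a` is the vertex occupied by the
agent `a` after the first `t` rounds `σ 0, …, σ (t - 1)`. -/
def position (σ : ℕ → Equiv.Perm V) : ℕ → V → V
  | 0, a => a
  | t + 1, a => σ t (position σ t a)

/-- The first `T` rounds of `σ` form a strategy for acquaintance in `G`: every two distinct agents
are adjacent at some time `0 ≤ t ≤ T` (time `0` being the initial placement). -/
def IsStrategy (G : SimpleGraph V) (T : ℕ) (σ : ℕ → Equiv.Perm V) : Prop :=
  (∀ t < T, IsRound G (σ t)) ∧
    ∀ a b : V, a ≠ b → ∃ t ≤ T, G.Adj (position σ t a) (position σ t b)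

/-- The acquaintance time: the minimal number of rounds of a strategy for acquaintance in `G`
(and `⊤` if there is no strategy). -/
noncomputable def acquaintanceTime (G : SimpleGraph V) : ℕ∞ :=
  ⨅ (T : ℕ) (_ : ∃ σ, IsStrategy G T σ), (T : ℕ∞)

/-- Legal rounds are the involutions that move every vertex along an edge or not at all. -/
theorem isRound_iff (G : SimpleGraph V) (σ : Equiv.Perm V) :
    IsRound G σ ↔ (∀ v, σ (σ v) = v) ∧ ∀ v, σ v ≠ v → G.Adj v (σ v) := by
  constructor
  · rintro ⟨M, hM, h1, h2⟩
    have key : ∀ v, v ∈ M.verts → M.Adj v (σ v) := by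
      intro v hv
      obtain ⟨w, hw, -⟩ := hM hv
      have := h1 v w hw
      rwa [this]
    refine ⟨fun v => ?_, fun v hv => ?_⟩
    · by_cases hv : v ∈ M.verts
      · exact h1 _ _ (key v hv).symm
      · rw [h2 v hv, h2 v hv]
    · by_cases h : v ∈ M.verts
      · exact (key v h).adj_sub
      · exact absurd (h2 v h) hv
  · rintro ⟨h1, h2⟩
    refine ⟨⟨{v | σ v ≠ v}, fun u v => σ u = v ∧ u ≠ v, ?_, ?_, ?_⟩, ?_, ?_, ?_⟩
    · rintro u v ⟨rfl, h⟩
      exact h2 u h.symm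
    · rintro u v ⟨rfl, h⟩
      exact h.symm
    · constructor
      rintro u v ⟨rfl, h⟩
      exact ⟨h1 u, h.symm⟩
    · intro v hv
      exact ⟨σ v, ⟨rfl, Ne.symm hv⟩, fun w hw => hw.1.symm⟩
    · rintro u v ⟨h, -⟩
      exact h
    · intro v hv
      by_contra h
      exact hv h

end Acquaintance

/-! Upper bound. Let `r` be the integer part of `√n`; the strategy depends on whether some degree
exceeds about `r`.

If `v` has at least `3k` neighbours, with `k` about `r / 3`, hang the rest of the graph in branches
on the neighbours of `v`. Reserve a set `A` of `k` neighbours as parking places; `v` and the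
branches not hanging on `A` form a tree `T`. All agents of `T` can be led through `v` in `O(n)`
rounds (`RTree.exists_rounds`). During one such tour the members of a group of `k` agents are parked
in `A`; during a second one everybody in `T` passes `v` and meets them (`RTree.sched_group`). With
`n / k + 1` groups this costs `O(n² / k)` rounds. Three disjoint choices of `A` handle all pairs,
since two agents lie in branches of at most two of them (`sched_of_large_degree`).

If all degrees are at most `Δ`, a spanning tree yields an ordering of the vertices in which
consecutive ones are at distance at most three and no vertex serves too many of the connecting paths
(`exists_linked_sequence`). Odd-even transposition along this ordering makes every two agents change
places within `n` steps (`exists_trajectory_meet`), and colouring the conflicts between paths lets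
one step be simulated in `O(Δ)` rounds (`exists_sched_transpose`). The total is `O(nΔ)`. Both cases
give `O(n √n)`.

Lower bound. In `windmill n r` a round uses at most one edge at the hub, so at most two agents
change their block. Hence a round creates only `O(r + n / r)` new acquaintances
(`windmill_round_new`), that is `O(√n)` for `r` about `√n`, while about `n²` ordered pairs have to
meet. -/

namespace Acquaintance

/-! ### Composing, reversing and uniting sequences of rounds -/

section Schedules

variable {V : Type*} {G : SimpleGraph V}

/-- The permutation resulting from carrying out the rounds of a list one after the other. -/
def net : List (Equiv.Perm V) → Equiv.Perm V
  | [] => 1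
  | σ :: l => net l * σ

/-- The agents that start at `x` and `y` are adjacent at some time while the rounds of the list
are carried out. -/
def Meets (G : SimpleGraph V) : List (Equiv.Perm V) → V → V → Prop
  | [], x, y => G.Adj x y
  | σ :: l, x, y => G.Adj x y ∨ Meets G l (σ x) (σ y)

/-- At most `T` rounds suffice to move the agents by `π` and to make all pairs in `M` meet. -/
def Sched (G : SimpleGraph V) (T : ℕ) (π : Equiv.Perm V) (M : V → V → Prop) : Prop :=
  ∃ l : List (Equiv.Perm V), l.length ≤ T ∧ (∀ σ ∈ l, IsRound G σ) ∧ net l = π ∧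
    ∀ x y, M x y → Meets G l x y

theorem net_append (l₁ l₂ : List (Equiv.Perm V)) : net (l₁ ++ l₂) = net l₂ * net l₁ := by
  induction l₁ with
  | nil => simp [net]
  | cons σ l ih => simp [net, ih, mul_assoc]

theorem Meets.of_adj {l : List (Equiv.Perm V)} {x y : V} (h : G.Adj x y) : Meets G l x y := by
  cases l with
  | nil => exact h
  | cons σ l => exact Or.inl h

theorem Meets.symm {l : List (Equiv.Perm V)} {x y : V} (h : Meets G l x y) : Meets G l y x := by
  induction l generalizing x y with
  | nil => exact SimpleGraph.Adj.symm h
  | cons σ l ih => exact h.imp (fun h => h.symm) ih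

theorem Meets.append_right {l₁ : List (Equiv.Perm V)} (l₂ : List (Equiv.Perm V)) {x y : V}
    (h : Meets G l₁ x y) : Meets G (l₁ ++ l₂) x y := by
  induction l₁ generalizing x y with
  | nil => exact Meets.of_adj h
  | cons σ l ih => exact h.imp id ih

theorem Meets.append_left (l₁ : List (Equiv.Perm V)) {l₂ : List (Equiv.Perm V)} {x y : V}
    (h : Meets G l₂ (net l₁ x) (net l₁ y)) : Meets G (l₁ ++ l₂) x y := by
  induction l₁ generalizing x y with
  | nil => exact h
  | cons σ l ih => exact Or.inr (ih h)

theorem isRound_one : IsRound G 1 := by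
  rw [isRound_iff]
  simp

theorem isRound_swap [DecidableEq V] {u v : V} (h : u = v ∨ G.Adj u v) :
    IsRound G (Equiv.swap u v) := by
  rw [isRound_iff]
  refine ⟨fun x => Equiv.swap_apply_self u v x, fun x hx => ?_⟩
  rcases h with rfl | h
  · simp at hx
  · by_cases h1 : x = u
    · subst h1; simpa using h
    · by_cases h2 : x = v
      · subst h2; simpa using h.symm
      · exact absurd (Equiv.swap_apply_of_ne_of_ne h1 h2) hx

theorem IsRound.apply_apply {σ : Equiv.Perm V} (h : IsRound G σ) (x : V) : σ (σ x) = x :=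
  ((isRound_iff G σ).1 h).1 x

theorem IsRound.mul {σ τ : Equiv.Perm V} (hσ : IsRound G σ) (hτ : IsRound G τ)
    (h : σ.Disjoint τ) : IsRound G (σ * τ) := by
  rw [isRound_iff] at *
  have hc : ∀ x, σ (τ x) = τ (σ x) := fun x => Equiv.Perm.ext_iff.1 h.commute.eq x
  refine ⟨fun v => ?_, fun v hv => ?_⟩
  · simp only [Equiv.Perm.mul_apply]
    rw [← hc (τ v), hτ.1, hσ.1]
  · simp only [Equiv.Perm.mul_apply] at hv ⊢
    rcases h v with h1 | h1
    · rw [hc, h1] at hv ⊢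
      exact hτ.2 v hv
    · rw [h1] at hv ⊢
      exact hσ.2 v hv

theorem Sched.mono {T T' : ℕ} {π : Equiv.Perm V} {M M' : V → V → Prop} (h : Sched G T π M)
    (hT : T ≤ T') (hM : ∀ x y, M' x y → M x y) : Sched G T' π M' := by
  obtain ⟨l, h1, h2, h3, h4⟩ := h
  exact ⟨l, h1.trans hT, h2, h3, fun x y hxy => h4 x y (hM x y hxy)⟩

theorem Sched.nil {M : V → V → Prop} (hM : ∀ x y, M x y → G.Adj x y) : Sched G 0 1 M :=
  ⟨[], by simp, by simp, rfl, hM⟩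

theorem Sched.round {σ : Equiv.Perm V} (h : IsRound G σ) {M : V → V → Prop}
    (hM : ∀ x y, M x y → G.Adj (σ x) (σ y)) : Sched G 1 σ M :=
  ⟨[σ], by simp, by simpa using h, by simp [net], fun x y hxy => Or.inr (hM x y hxy)⟩

theorem Sched.comp {T₁ T₂ : ℕ} {π₁ π₂ : Equiv.Perm V} {M₁ M₂ : V → V → Prop}
    (h₁ : Sched G T₁ π₁ M₁) (h₂ : Sched G T₂ π₂ M₂) :
    Sched G (T₁ + T₂) (π₂ * π₁) (fun x y => M₁ x y ∨ M₂ (π₁ x) (π₁ y)) := by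
  obtain ⟨l, h1, h2, rfl, h4⟩ := h₁
  obtain ⟨l', h1', h2', rfl, h4'⟩ := h₂
  refine ⟨l ++ l', by simp; omega, ?_, net_append _ _, ?_⟩
  · intro σ hσ
    rcases List.mem_append.1 hσ with h | h
    exacts [h2 _ h, h2' _ h]
  · rintro x y (h | h)
    · exact (h4 x y h).append_right _
    · exact Meets.append_left _ (h4' _ _ h)

theorem net_reverse {l : List (Equiv.Perm V)} (h : ∀ σ ∈ l, IsRound G σ) :
    net l.reverse = (net l)⁻¹ := by
  induction l with
  | nil => simp [net]
  | cons σ l ih =>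
    have hσ : σ⁻¹ = σ := by
      ext x
      rw [Equiv.Perm.inv_eq_iff_eq]
      exact ((h σ (by simp)).apply_apply x).symm
    rw [List.reverse_cons, net_append, ih fun τ hτ => h τ (by simp [hτ])]
    simp [net, hσ]

/-- Rounds are involutions, so playing them backwards restores the initial placement. At twice the
cost, tasks become independent of each other and can be carried out in any order. -/
theorem Sched.undo {T : ℕ} {π : Equiv.Perm V} {M : V → V → Prop} (h : Sched G T π M) :
    Sched G (2 * T) 1 M := by
  obtain ⟨l, h1, h2, rfl, h4⟩ := h
  refine ⟨l ++ l.reverse, by simp; omega, ?_, ?_, fun x y h => (h4 x y h).append_right _⟩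
  · intro σ hσ
    exact h2 σ (by simpa using hσ)
  · rw [net_append, net_reverse h2, inv_mul_cancel]

theorem Sched.biUnion {ι : Type*} (s : Finset ι) {T : ℕ} {M : ι → V → V → Prop}
    (h : ∀ i ∈ s, Sched G T 1 (M i)) :
    Sched G (s.card * T) 1 (fun x y => ∃ i ∈ s, M i x y) := by
  classical
  induction s using Finset.induction_on with
  | empty => simpa using Sched.nil (G := G) (M := fun _ _ => False) (by simp)
  | insert i s hi ih =>
    have := (h i (by simp)).comp (ih fun j hj => h j (by simp [hj]))
    rw [mul_one] at this
    refine this.mono (by rw [Finset.card_insert_of_notMem hi]; ring_nf; rfl) ?_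
    rintro x y ⟨j, hj, hm⟩
    rcases Finset.mem_insert.1 hj with rfl | hj
    · exact Or.inl hm
    · exact Or.inr ⟨j, hj, hm⟩

theorem position_succ_eq (σ : ℕ → Equiv.Perm V) (t : ℕ) (a : V) :
    position σ (t + 1) a = position (fun i => σ (i + 1)) t (σ 0 a) := by
  induction t with
  | zero => rfl
  | succ t ih => rw [position, ih, position]

theorem Meets.exists_position {l : List (Equiv.Perm V)} {x y : V} (h : Meets G l x y) :
    ∃ t ≤ l.length, G.Adj (position (fun i => l.getD i 1) t x)
      (position (fun i => l.getD i 1) t y) := by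
  induction l generalizing x y with
  | nil => exact ⟨0, le_rfl, h⟩
  | cons σ l ih =>
    rcases h with h | h
    · exact ⟨0, by simp, h⟩
    · obtain ⟨t, ht, hadj⟩ := ih h
      refine ⟨t + 1, by simpa using ht, ?_⟩
      simpa [position_succ_eq] using hadj

theorem Sched.exists_isStrategy {T : ℕ} {π : Equiv.Perm V} (h : Sched G T π (fun x y => x ≠ y)) :
    ∃ T' ≤ T, ∃ σ, IsStrategy G T' σ := by
  obtain ⟨l, h1, h2, -, h4⟩ := h
  refine ⟨l.length, h1, fun i => l.getD i 1, fun t ht => ?_, fun a b hab =>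
    (h4 a b hab).exists_position⟩
  show IsRound G (l.getD t 1)
  rw [List.getD_eq_getElem _ _ ht]
  exact h2 _ (List.getElem_mem ht)

theorem exists_acquaintanceTime_eq {T : ℕ} (h : ∃ σ, IsStrategy G T σ) :
    ∃ m ≤ T, acquaintanceTime G = m ∧ ∃ σ, IsStrategy G m σ := by
  classical
  have hex : ∃ T, ∃ σ, IsStrategy G T σ := ⟨T, h⟩
  refine ⟨Nat.find hex, Nat.find_min' hex h, le_antisymm ?_ ?_, Nat.find_spec hex⟩
  · exact iInf₂_le (Nat.find hex) (Nat.find_spec hex)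
  · refine le_iInf₂ fun T hT => ?_
    exact_mod_cast Nat.find_min' hex hT

end Schedules

/-! ### Spanning trees built by joining roots -/

section RootedTrees

variable {V : Type*} {G : SimpleGraph V}

theorem exists_adj_of_connected (hG : G.Connected) {S : Finset V} {v u : V} (hv : v ∈ S)
    (hu : u ∉ S) : ∃ x ∈ S, ∃ y, y ∉ S ∧ G.Adj x y := by
  obtain ⟨p⟩ := hG.preconnected v u
  obtain ⟨d, -, h1, h2⟩ := p.exists_boundary_dart (S : Set V) (by simpa using hv) (by simpa using hu)
  exact ⟨d.fst, by simpa using h1, d.snd, by simpa using h2, d.adj⟩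

variable [DecidableEq V]

/-- A tree in `G` with vertex set `S` and root `v`, put together by joining the root of one tree
to the root of another one. -/
inductive RTree (G : SimpleGraph V) : Finset V → V → Prop
  | single (v : V) : RTree G {v} v
  | join {S₁ S₂ : Finset V} {c v : V} : RTree G S₁ c → RTree G S₂ v → Disjoint S₁ S₂ →
      G.Adj v c → RTree G (S₁ ∪ S₂) v

theorem RTree.root_mem {S : Finset V} {v : V} (h : RTree G S v) : v ∈ S := by
  induction h with
  | single v => simp
  | join _ _ _ _ _ ih => simp [ih]

theorem RTree.extend {S : Finset V} {v u w : V} (h : RTree G S v) (hu : u ∉ S) (hw : w ∈ S)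
    (hwu : G.Adj w u) : RTree G (insert u S) v := by
  induction h with
  | single v =>
    obtain rfl : w = v := by simpa using hw
    exact RTree.join (RTree.single u) (RTree.single w) (by simpa using hu) hwu
  | @join S₁ S₂ c v h₁ h₂ hd hadj ih₁ ih₂ =>
    simp only [Finset.mem_union, not_or] at hu
    rcases Finset.mem_union.1 hw with h | h
    · rw [← Finset.insert_union]
      exact RTree.join (ih₁ hu.1 h) h₂ (Finset.disjoint_insert_left.2 ⟨hu.2, hd⟩) hadj
    · rw [← Finset.union_insert]
      exact RTree.join h₁ (ih₂ hu.2 h) (Finset.disjoint_insert_right.2 ⟨hu.1, hd⟩) hadj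

theorem RTree.univ [Fintype V] (hG : G.Connected) (v : V) : RTree G Finset.univ v := by
  have key : ∀ k, k + 1 ≤ Fintype.card V → ∃ S : Finset V, S.card = k + 1 ∧ RTree G S v := by
    intro k
    induction k with
    | zero => exact fun _ => ⟨{v}, by simp, RTree.single v⟩
    | succ k ih =>
      intro hk
      obtain ⟨S, hS, hT⟩ := ih (by omega)
      have : ∃ u, u ∉ S := by
        by_contra! h
        have : S = Finset.univ := by ext; simp [h]
        rw [this, Finset.card_univ] at hS
        omega
      obtain ⟨u, hu⟩ := this
      obtain ⟨x, hx, y, hy, hxy⟩ := exists_adj_of_connected hG hT.root_mem hu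
      exact ⟨insert y S, by rw [Finset.card_insert_of_notMem hy, hS], hT.extend hy hx hxy⟩
  have hpos : 0 < Fintype.card V := Fintype.card_pos_iff.2 ⟨v⟩
  obtain ⟨S, hS, hT⟩ := key (Fintype.card V - 1) (by omega)
  rwa [Finset.eq_univ_of_card S (by omega)] at hT

end RootedTrees

/-! ### Leading all agents of a tree to its root -/

section VisitingTheRoot

variable {V : Type*} {G : SimpleGraph V}

/-- The agent that starts at `x` is at `v` at some time while the rounds of the list are
carried out. -/
def Visits : List (Equiv.Perm V) → V → V → Prop
  | [], x, v => x = v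
  | σ :: l, x, v => x = v ∨ Visits l (σ x) v

theorem Visits.refl (l : List (Equiv.Perm V)) (v : V) : Visits l v v := by
  cases l with
  | nil => rfl
  | cons σ l => exact Or.inl rfl

theorem Visits.append_right {l₁ : List (Equiv.Perm V)} (l₂ : List (Equiv.Perm V)) {x v : V}
    (h : Visits l₁ x v) : Visits (l₁ ++ l₂) x v := by
  induction l₁ generalizing x with
  | nil => rw [show x = v from h]; exact Visits.refl _ _
  | cons σ l ih => exact h.imp id ih

theorem Visits.append_left {l₁ : List (Equiv.Perm V)} {l₂ : List (Equiv.Perm V)} {x v : V}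
    (h : Visits l₂ x v) (hx : ∀ σ ∈ l₁, σ x = x) : Visits (l₁ ++ l₂) x v := by
  induction l₁ with
  | nil => exact h
  | cons σ l ih =>
    refine Or.inr ?_
    rw [hx σ (by simp)]
    exact ih fun τ hτ => hx τ (by simp [hτ])

/-- All the first and second components of a list of pairs, in order. -/
def flatten (l : List (Equiv.Perm V × Equiv.Perm V)) : List (Equiv.Perm V) :=
  l.flatMap fun p => [p.1, p.2]

theorem length_flatten (l : List (Equiv.Perm V × Equiv.Perm V)) :
    (flatten l).length = 2 * l.length := by
  induction l with
  | nil => rfl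
  | cons p l ih =>
    simp only [flatten, List.flatMap_cons, List.length_append, List.length_cons] at ih ⊢
    simp only [List.length_nil]
    omega

theorem Visits.flatten {l : List (Equiv.Perm V × Equiv.Perm V)} {x v : V}
    (h : Visits (l.map fun p => p.2 * p.1) x v) : Visits (flatten l) x v := by
  induction l generalizing x with
  | nil => exact h
  | cons p l ih => exact h.imp id fun h => Or.inr (ih h)

/-- `s` is carried out together with the first component of each pair, and once more at the end;
`b` is a pending move. -/
def interleave (s : Equiv.Perm V) :
    Equiv.Perm V → List (Equiv.Perm V × Equiv.Perm V) → List (Equiv.Perm V × Equiv.Perm V)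
  | b, [] => [(b, s)]
  | b, p :: l => (b, s * p.1) :: interleave s p.2 l

theorem length_interleave (s b : Equiv.Perm V) (l : List (Equiv.Perm V × Equiv.Perm V)) :
    (interleave s b l).length = l.length + 1 := by
  induction l generalizing b with
  | nil => rfl
  | cons p l ih => simp [interleave, ih]

theorem forall_mem_interleave {P Q : Equiv.Perm V → Prop} {s b : Equiv.Perm V}
    {l : List (Equiv.Perm V × Equiv.Perm V)} (hb : P b) (hs : Q s)
    (h1 : ∀ p ∈ l, Q (s * p.1)) (h2 : ∀ p ∈ l, P p.2) :
    ∀ p ∈ interleave s b l, P p.1 ∧ Q p.2 := by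
  induction l generalizing b with
  | nil => simpa [interleave] using ⟨hb, hs⟩
  | cons p l ih =>
    intro q hq
    rcases List.mem_cons.1 hq with rfl | hq
    · exact ⟨hb, h1 p (by simp)⟩
    · exact ih (h2 p (by simp)) (fun r hr => h1 r (by simp [hr])) (fun r hr => h2 r (by simp [hr]))
        q hq

theorem apply_mem_of_fixes {S : Finset V} {σ : Equiv.Perm V} (h : ∀ x, x ∉ S → σ x = x) {x : V}
    (hx : x ∈ S) : σ x ∈ S := by
  by_contra hn
  have := σ.injective (h _ hn)
  rw [this] at hn
  exact hn hx

theorem Visits.meets {l : List (Equiv.Perm V)} {x a : V} (h : Visits l x v) (hva : G.Adj v a)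
    (ha : ∀ σ ∈ l, σ a = a) : Meets G l x a := by
  induction l generalizing x with
  | nil => rw [show x = v from h]; exact hva
  | cons σ l ih =>
    rcases h with rfl | h
    · exact Or.inl hva
    · refine Or.inr ?_
      rw [ha σ (by simp)]
      exact ih h fun τ hτ => ha τ (by simp [hτ])

variable [DecidableEq V]

/-- The swap of `v` and `c` shares a round with `p.1`, which fixes `c`. An agent that has not yet
reached `c` is touched by no such swap and so follows the original schedule of the branch; once at
`c`, it is lifted to `v` by the next swap. Agents pushed down from `v` may be scattered, but only
first visits matter. The pairs are regrouped with a shift of one round, so that the swaps become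
second components and `v` rests during the first ones. -/
theorem Visits.interleave {S : Finset V} {c v : V} (hv : v ∉ S)
    {l : List (Equiv.Perm V × Equiv.Perm V)}
    (hl : ∀ p ∈ l, p.1 c = c ∧ ∀ x, x ∉ S → p.1 x = x ∧ p.2 x = x) {x : V} (hx : x ∈ S)
    (h : Visits (l.map fun p => p.2 * p.1) x c) {b : Equiv.Perm V} {z : V} (hz : b z = x) :
    Visits ((interleave (Equiv.swap v c) b l).map fun p => p.2 * p.1) z v := by
  induction l generalizing x b z with
  | nil =>
    obtain rfl : x = c := h
    exact Or.inr (by simp [hz, Visits])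
  | cons p l ih =>
    obtain ⟨hp1, hp2⟩ := hl p (by simp)
    have hl' : ∀ p ∈ l, p.1 c = c ∧ ∀ x, x ∉ S → p.1 x = x ∧ p.2 x = x :=
      fun r hr => hl r (by simp [hr])
    refine Or.inr ?_
    by_cases hxc : x = c
    · subst hxc
      have : (Equiv.swap v x * p.1 * b) z = v := by simp [hz, hp1]
      simp only [this]
      exact Visits.refl _ _
    · have h' := h.resolve_left hxc
      have h1 : p.1 x ∈ S := apply_mem_of_fixes (fun y hy => (hp2 y hy).1) hx
      have h2 : p.2 (p.1 x) ∈ S := apply_mem_of_fixes (fun y hy => (hp2 y hy).2) h1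
      refine ih hl' h2 h' ?_
      have h3 : Equiv.swap v c (p.1 x) = p.1 x := by
        refine Equiv.swap_apply_of_ne_of_ne (fun h => hv (h ▸ h1)) fun h => hxc ?_
        exact p.1.injective (h.trans hp1.symm)
      simp [hz, h3]

/-- In a tree, all agents can be led to the root within a linear number of rounds. The root stays
in place in every other round, so that the tree can be used as a branch of a larger one. -/
theorem RTree.exists_visits {S : Finset V} {v : V} (h : RTree G S v) :
    ∃ l : List (Equiv.Perm V × Equiv.Perm V), l.length + 1 = S.card ∧
      (∀ p ∈ l, IsRound G p.1 ∧ IsRound G p.2 ∧ p.1 v = v ∧ ∀ x, x ∉ S → p.1 x = x ∧ p.2 x = x) ∧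
      ∀ x ∈ S, Visits (l.map fun p => p.2 * p.1) x v := by
  induction h with
  | single v => exact ⟨[], by simp, by simp, fun x hx => Finset.mem_singleton.1 hx⟩
  | @join S₁ S₂ c v h₁ h₂ hd hadj ih₁ ih₂ =>
    obtain ⟨l₁, hc₁, hr₁, hv₁⟩ := ih₁
    obtain ⟨l₂, hc₂, hr₂, hv₂⟩ := ih₂
    have hvS : v ∉ S₁ := fun h => Finset.disjoint_left.1 hd h h₂.root_mem
    have hcS := h₁.root_mem
    have hint : ∀ p ∈ Acquaintance.interleave (Equiv.swap v c) 1 l₁,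
        (IsRound G p.1 ∧ ∀ x, x ∉ S₁ → p.1 x = x) ∧
        (IsRound G p.2 ∧ ∀ x, x ∉ S₁ → x ≠ v → p.2 x = x) := by
      refine forall_mem_interleave (P := fun σ => IsRound G σ ∧ ∀ x, x ∉ S₁ → σ x = x)
        (Q := fun σ => IsRound G σ ∧ ∀ x, x ∉ S₁ → x ≠ v → σ x = x)
        ⟨isRound_one, by simp⟩ ⟨isRound_swap (Or.inr hadj), ?_⟩ ?_ ?_
      · intro x hx hxv
        exact Equiv.swap_apply_of_ne_of_ne hxv fun h => hx (h ▸ hcS)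
      · intro p hp
        obtain ⟨hp1, hp2, hp3, hp4⟩ := hr₁ p hp
        refine ⟨(isRound_swap (Or.inr hadj)).mul hp1 fun x => ?_, fun x hx hxv => ?_⟩
        · by_cases hxv : x = v
          · exact Or.inr (hxv ▸ (hp4 v hvS).1)
          · by_cases hxc : x = c
            · exact Or.inr (hxc ▸ hp3)
            · exact Or.inl (Equiv.swap_apply_of_ne_of_ne hxv hxc)
        · rw [Equiv.Perm.mul_apply, (hp4 x hx).1]
          exact Equiv.swap_apply_of_ne_of_ne hxv fun h => hx (h ▸ hcS)
      · intro p hp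
        exact ⟨(hr₁ p hp).2.1, fun x hx => ((hr₁ p hp).2.2.2 x hx).2⟩
    -- Empty the branch at `c` first; meanwhile the agents of `S₂` other than the one at `v` stand
    -- still, and the latter has already visited the root. The extra pair of `interleave` accounts
    -- for the edge joining the two trees.
    refine ⟨Acquaintance.interleave (Equiv.swap v c) 1 l₁ ++ l₂, ?_, ?_, ?_⟩
    · rw [List.length_append, length_interleave, Finset.card_union_of_disjoint hd]
      omega
    · intro p hp
      rcases List.mem_append.1 hp with hp | hp
      · obtain ⟨⟨h1, h2⟩, h3, h4⟩ := hint p hp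
        refine ⟨h1, h3, h2 v hvS, fun x hx => ?_⟩
        simp only [Finset.mem_union, not_or] at hx
        exact ⟨h2 x hx.1, h4 x hx.1 fun h => hx.2 (h ▸ h₂.root_mem)⟩
      · obtain ⟨h1, h2, h3, h4⟩ := hr₂ p hp
        refine ⟨h1, h2, h3, fun x hx => h4 x fun h => hx (Finset.mem_union_right _ h)⟩
    · intro x hx
      rw [List.map_append]
      by_cases hx1 : x ∈ S₁
      · exact (Visits.interleave hvS (fun p hp => (hr₁ p hp).2.2) hx1 (hv₁ x hx1)
          (b := 1) rfl).append_right _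
      · have hx2 : x ∈ S₂ := (Finset.mem_union.1 hx).resolve_left hx1
        by_cases hxv : x = v
        · rw [hxv]; exact Visits.refl _ _
        · refine (hv₂ x hx2).append_left fun σ hσ => ?_
          obtain ⟨p, hp, rfl⟩ := List.mem_map.1 hσ
          obtain ⟨⟨-, h2⟩, -, h4⟩ := hint p hp
          rw [Equiv.Perm.mul_apply, h2 x hx1, h4 x hx1 hxv]

theorem RTree.exists_rounds {S : Finset V} {v : V} (h : RTree G S v) :
    ∃ l : List (Equiv.Perm V), l.length + 2 = 2 * S.card ∧
      (∀ σ ∈ l, IsRound G σ ∧ ∀ x, x ∉ S → σ x = x) ∧ ∀ x ∈ S, Visits l x v := by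
  obtain ⟨l, h1, h2, h3⟩ := h.exists_visits
  refine ⟨Acquaintance.flatten l, by rw [length_flatten]; omega, fun σ hσ => ?_,
    fun x hx => (h3 x hx).flatten⟩
  obtain ⟨p, hp, hσ⟩ := List.mem_flatMap.1 hσ
  obtain ⟨h1, h2, -, h4⟩ := h2 p hp
  simp only [List.mem_cons, List.not_mem_nil, or_false] at hσ
  rcases hσ with rfl | rfl
  exacts [⟨h1, fun x hx => (h4 x hx).1⟩, ⟨h2, fun x hx => (h4 x hx).2⟩]

end VisitingTheRoot

/-! ### Fast strategies from a vertex of large degree -/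

section Star

variable {V : Type*} [DecidableEq V] {G : SimpleGraph V} {T A : Finset V} {v : V}

/-- Here `S` is the set of current positions of the group. If a member stands at `v`, which is
outside `A`, then `S.card ≤ A.card` leaves a place in `A` not occupied by the group, and the member
moves there. -/
theorem exists_round_parking (hA : ∀ a ∈ A, G.Adj v a) (hvA : v ∉ A) {S : Finset V}
    (hS : S.card ≤ A.card) :
    ∃ τ, IsRound G τ ∧ (v ∈ S → τ v ∈ A) ∧ (∀ s ∈ S, s ∈ A → τ s ∈ A) ∧
      ∀ x, x ∉ A → x ≠ v → τ x = x := by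
  by_cases hv : v ∈ S
  · have : ∃ a ∈ A, a ∉ S := by
      by_contra! h
      have : A ⊂ S := Finset.ssubset_iff_subset_ne.2 ⟨h, fun h => hvA (h ▸ hv)⟩
      exact absurd (Finset.card_lt_card this) (by omega)
    obtain ⟨a, ha, haS⟩ := this
    refine ⟨Equiv.swap v a, isRound_swap (Or.inr (hA a ha)), fun _ => by simpa using ha,
      fun s hs hsA => ?_, fun x hx hxv => ?_⟩
    · have h1 : s ≠ v := fun h => hvA (h ▸ hsA)
      have h2 : s ≠ a := fun h => haS (h ▸ hs)
      rwa [Equiv.swap_apply_of_ne_of_ne h1 h2]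
    · exact Equiv.swap_apply_of_ne_of_ne hxv fun h => hx (h ▸ ha)
  · exact ⟨1, isRound_one, fun h => absurd h hv, fun s _ h => h, fun _ _ _ => rfl⟩

/-- While the agents are led through `v`, the members of a small set of agents can be parked at
neighbours of `v`. -/
theorem exists_sched_parking (hA : ∀ a ∈ A, G.Adj v a) (hvT : v ∈ T) (hTA : Disjoint T A)
    {l : List (Equiv.Perm V)} (hl : ∀ σ ∈ l, IsRound G σ ∧ ∀ x, x ∉ T → σ x = x)
    {S : Finset V} (hS : S.card ≤ A.card) :
    ∃ π, Sched G (2 * l.length + 1) π (fun _ _ => False) ∧ (∀ s ∈ S, s ∈ A → π s ∈ A) ∧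
      (∀ s ∈ S, s ∈ T → Visits l s v → π s ∈ A) ∧ ∀ x ∈ T ∪ A, π x ∈ T ∪ A := by
  have hvA : v ∉ A := Finset.disjoint_left.1 hTA hvT
  induction l generalizing S with
  | nil =>
    obtain ⟨τ, h1, h2, h3, h4⟩ := exists_round_parking hA hvA hS
    refine ⟨τ, Sched.round h1 (by simp), h3, ?_, fun x hx => ?_⟩
    · intro s hs _ hsv
      obtain rfl : s = v := hsv
      exact h2 hs
    · refine apply_mem_of_fixes (fun y hy => ?_) hx
      simp only [Finset.mem_union, not_or] at hy
      exact h4 y hy.2 fun h => hy.1 (h ▸ hvT)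
  | cons σ l ih =>
    obtain ⟨τ, h1, h2, h3, h4⟩ := exists_round_parking hA hvA hS
    obtain ⟨hσ1, hσ2⟩ := hl σ (by simp)
    have hσA : ∀ a ∈ A, σ a = a := fun a ha => hσ2 a fun h => Finset.disjoint_left.1 hTA h ha
    -- A parking round `τ` precedes each round `σ` of the tour, and the positions of the group are
    -- pushed forward through both. One more parking round at the end serves an agent that reaches
    -- `v` last, whence `2 * l.length + 1`.
    obtain ⟨π, k1, k2, k3, k4⟩ := ih (fun ρ hρ => hl ρ (by simp [hρ]))
      (S := S.image fun s => σ (τ s)) (Finset.card_image_le.trans hS)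
    have hmem : ∀ s ∈ S, σ (τ s) ∈ S.image fun s => σ (τ s) :=
      fun s hs => Finset.mem_image_of_mem (fun s => σ (τ s)) hs
    refine ⟨π * (σ * τ), ?_, fun s hs hsA => ?_, fun s hs hsT hvis => ?_, fun x hx => ?_⟩
    · have := ((Sched.round (G := G) h1 (M := fun _ _ => False) (by simp)).comp
        (Sched.round (G := G) hσ1 (M := fun _ _ => False) (by simp))).comp k1
      exact this.mono (by simp only [List.length_cons]; omega) (by simp)
    · have : σ (τ s) = τ s := hσA _ (h3 s hs hsA)
      exact k2 _ (hmem s hs) (by rw [Equiv.Perm.mul_apply, this]; exact h3 s hs hsA)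
    · by_cases hsv : s = v
      · subst hsv
        have : σ (τ s) = τ s := hσA _ (h2 hs)
        exact k2 _ (hmem s hs) (by rw [Equiv.Perm.mul_apply, this]; exact h2 hs)
      · have hτ : τ s = s := h4 s (Finset.disjoint_left.1 hTA hsT) hsv
        refine k3 _ (hmem s hs) ?_ ?_
        · rw [Equiv.Perm.mul_apply, hτ]
          exact apply_mem_of_fixes hσ2 hsT
        · rw [Equiv.Perm.mul_apply, hτ]
          exact hvis.resolve_left hsv
    · refine k4 _ ?_
      refine apply_mem_of_fixes (σ := σ * τ) (fun y hy => ?_) hx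
      simp only [Finset.mem_union, not_or] at hy
      rw [Equiv.Perm.mul_apply, h4 y hy.2 fun h => hy.1 (h ▸ hvT)]
      exact hσ2 y hy.1

/-- An agent swapped from `A` to `v` sees all the others in `A`; each takes its turn and returns. -/
theorem sched_rotate (hA : ∀ a ∈ A, G.Adj v a) (hvA : v ∉ A) :
    Sched G (A.card * 2) 1 (fun x y => x ∈ A ∧ y ∈ A ∧ x ≠ y) := by
  refine (Sched.biUnion A (T := 2) (M := fun a x y => x = a ∧ y ∈ A ∧ x ≠ y)
    fun a ha => ?_).mono le_rfl fun x y h => ⟨x, h.1, rfl, h.2⟩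
  refine (Sched.round (isRound_swap (Or.inr (hA a ha))) ?_).undo
  rintro x y ⟨rfl, hy, hxy⟩
  have hyv : y ≠ v := fun h => hvA (h ▸ hy)
  rw [Equiv.swap_apply_right, Equiv.swap_apply_of_ne_of_ne hyv (Ne.symm hxy)]
  exact hA y hy

/-- Three phases: a tour on which the group is parked in `A`, a rotation of `A` through `v`, and a
second tour during which `A` stands still. After the first tour an agent from `T` is either in `T`,
and meets the parked ones when it passes `v`, or in `A`, and meets them in the rotation. With tours
of `2 * T.card - 2` rounds and the final undoing, the cost stays within `12 * T.card + 4 * A.card`.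
-/
theorem RTree.sched_group (hT : RTree G T v) (hA : ∀ a ∈ A, G.Adj v a) (hTA : Disjoint T A)
    {S : Finset V} (hS : S.card ≤ A.card) :
    Sched G (12 * T.card + 4 * A.card) 1 (fun x s => x ∈ T ∧ s ∈ T ∧ s ∈ S ∧ x ≠ s) := by
  have hvT := hT.root_mem
  have hvA : v ∉ A := Finset.disjoint_left.1 hTA hvT
  obtain ⟨l, hl1, hl2, hl3⟩ := hT.exists_rounds
  obtain ⟨π, k1, k2, k3, k4⟩ := exists_sched_parking hA hvT hTA hl2 hS
  have hP : Sched G l.length (net l) (fun x a => x ∈ T ∧ a ∈ A) := by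
    refine ⟨l, le_rfl, fun σ hσ => (hl2 σ hσ).1, rfl, fun x a h => ?_⟩
    exact (hl3 x h.1).meets (hA a h.2) fun σ hσ =>
      (hl2 σ hσ).2 a fun h' => Finset.disjoint_left.1 hTA h' h.2
  refine ((k1.comp (sched_rotate hA hvA)).comp hP).undo.mono (by omega) ?_
  rintro x s ⟨hx, hs, hsS, hxs⟩
  have h1 := k3 s hsS hs (hl3 s hs)
  rcases Finset.mem_union.1 (k4 x (Finset.mem_union_left _ hx)) with h | h
  · exact Or.inr ⟨h, h1⟩
  · exact Or.inl (Or.inr ⟨h, h1, fun h => hxs (π.injective h)⟩)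

/-- Number the agents and cut the numbering into intervals of length `A.card`; each interval is one
group. -/
theorem RTree.sched_of_leaves [Fintype V] (hT : RTree G T v) (hA : ∀ a ∈ A, G.Adj v a)
    (hTA : Disjoint T A) (hpos : 0 < A.card) :
    Sched G ((Fintype.card V / A.card + 1) * (16 * Fintype.card V)) 1
      (fun x y => x ∈ T ∧ y ∈ T ∧ x ≠ y) := by
  set n := Fintype.card V with hn
  set k := A.card with hk
  let e : V ≃ Fin n := Fintype.equivFin V
  have hcard : T.card ≤ n ∧ A.card ≤ n := ⟨Finset.card_le_univ _, Finset.card_le_univ _⟩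
  have := Sched.biUnion (G := G) (Finset.range (n / k + 1)) (T := 16 * n)
    (M := fun g x s => x ∈ T ∧ s ∈ T ∧ s ∈ Finset.univ.filter (fun s => (e s : ℕ) / k = g) ∧ x ≠ s)
    fun g _ => (hT.sched_group hA hTA ?_).mono (by omega) fun _ _ h => h
  · rw [Finset.card_range] at this
    refine this.mono le_rfl ?_
    rintro x y ⟨hx, hy, hxy⟩
    refine ⟨(e y : ℕ) / k, ?_, hx, hy, by simp, hxy⟩
    rw [Finset.mem_range, Nat.lt_succ_iff]
    exact Nat.div_le_div_right (e y).2.le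
  · have : (Finset.Ico (g * k) (g * k + k)).card = A.card := by simp [hk]
    rw [← this]
    refine Finset.card_le_card_of_injOn (fun s => (e s : ℕ)) ?_ ?_
    · intro s hs
      simp only [Finset.coe_filter, Finset.mem_univ, true_and, Set.mem_ofPred_eq] at hs
      rw [Nat.div_eq_iff hpos] at hs
      simp only [Finset.coe_Ico, Set.mem_Ico]
      omega
    · intro s _ s' _ h
      exact e.injective (Fin.ext h)

/-- Away from a vertex `v`, a connected graph can be partitioned into trees rooted at the
neighbours of `v`. -/
theorem exists_branches [Fintype V] [DecidableRel G.Adj] (hG : G.Connected) (v : V) :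
    ∃ f : V → V, (∀ u, u ≠ v → G.Adj v (f u)) ∧
      ∀ c, G.Adj v c → RTree G (Finset.univ.filter fun u => u ≠ v ∧ f u = c) c := by
  have key : ∀ m (D : Finset V) (f : V → V), D.card + m = Fintype.card V → v ∉ D →
      (∀ c, G.Adj v c → c ∈ D) → (∀ u ∈ D, G.Adj v (f u)) →
      (∀ c, G.Adj v c → RTree G (D.filter fun u => f u = c) c) →
      ∃ f : V → V, (∀ u, u ≠ v → G.Adj v (f u)) ∧
        ∀ c, G.Adj v c → RTree G (Finset.univ.filter fun u => u ≠ v ∧ f u = c) c := by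
    intro m
    induction m with
    | zero =>
      intro D f hD hv
      exact absurd (Finset.eq_univ_of_card D (by omega) ▸ Finset.mem_univ v) hv
    | succ m ih =>
      intro D f hD hv hN hf hT
      by_cases hall : ∀ u, u ≠ v → u ∈ D
      · refine ⟨f, fun u hu => hf u (hall u hu), fun c hc => ?_⟩
        convert hT c hc using 1
        ext u
        simp only [Finset.mem_filter, Finset.mem_univ, true_and]
        exact ⟨fun h => ⟨hall u h.1, h.2⟩, fun h => ⟨fun h' => hv (h' ▸ h.1), h.2⟩⟩
      · push Not at hall
        obtain ⟨u, huv, huD⟩ := hall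
        -- An edge leaving `D ∪ {v}` cannot start at `v`, whose neighbours all lie in `D`; so its
        -- outer end joins the branch of its inner end.
        obtain ⟨x, hx, y, hy, hxy⟩ := exists_adj_of_connected hG (S := insert v D) (v := v) (u := u)
          (by simp) (by simp [huv, huD])
        simp only [Finset.mem_insert, not_or] at hx hy
        have hxD : x ∈ D := hx.resolve_left fun h => hy.2 (hN y (h ▸ hxy))
        have hfD : ∀ u ∈ D, Function.update f y (f x) u = f u := fun u hu =>
          Function.update_of_ne (by rintro rfl; exact hy.2 hu) _ _
        refine ih (insert y D) (Function.update f y (f x)) ?_ ?_ ?_ ?_ ?_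
        · rw [Finset.card_insert_of_notMem hy.2]
          omega
        · simp [hv, Ne.symm hy.1]
        · exact fun c hc => Finset.mem_insert_of_mem (hN c hc)
        · intro u hu
          rcases Finset.mem_insert.1 hu with rfl | hu
          · rw [Function.update_self]
            exact hf x hxD
          · rw [hfD u hu]
            exact hf u hu
        · intro c hc
          have h1 : D.filter (fun u => Function.update f y (f x) u = c) =
              D.filter fun u => f u = c := Finset.filter_congr fun u hu => by rw [hfD u hu]
          rw [Finset.filter_insert, Function.update_self, h1]
          split_ifs with h
          · exact (hT c hc).extend (by simp [hy.2]) (Finset.mem_filter.2 ⟨hxD, h⟩) hxy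
          · exact hT c hc
  refine key (Fintype.card V - (G.neighborFinset v).card) (G.neighborFinset v) id ?_ (by simp)
    (by simp) (by simp) ?_
  · have := Finset.card_le_univ (G.neighborFinset v)
    omega
  · intro c hc
    convert RTree.single (G := G) c
    ext u
    simp only [Finset.mem_filter, SimpleGraph.mem_neighborFinset, id, Finset.mem_singleton]
    exact ⟨fun h => h.2, fun h => ⟨h ▸ hc, h⟩⟩

theorem RTree.of_branches [Fintype V] {f : V → V}
    (hf : ∀ c, G.Adj v c → RTree G (Finset.univ.filter fun u => u ≠ v ∧ f u = c) c)
    (B : Finset V) (hB : ∀ c ∈ B, G.Adj v c) :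
    RTree G (insert v (Finset.univ.filter fun u => u ≠ v ∧ f u ∈ B)) v := by
  induction B using Finset.induction_on with
  | empty => simpa using RTree.single (G := G) v
  | insert c B hc ih =>
    convert RTree.join (hf c (hB c (by simp))) (ih fun c hc => hB c (by simp [hc])) ?_
      (hB c (by simp)) using 1
    · ext u
      simp only [Finset.mem_insert, Finset.mem_filter, Finset.mem_univ, true_and, Finset.mem_union]
      tauto
    · rw [Finset.disjoint_left]
      intro u hu hu'
      simp only [Finset.mem_insert, Finset.mem_filter, Finset.mem_univ, true_and] at hu hu'
      rcases hu' with h | h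
      · exact hu.1 h
      · exact hc (hu.2 ▸ h.2)

/-- A vertex with many neighbours gives a fast strategy. -/
theorem sched_of_large_degree [Fintype V] [DecidableRel G.Adj] (hG : G.Connected) (v : V) {k : ℕ}
    (hk : 0 < k) (hdeg : 3 * k ≤ G.degree v) :
    Sched G (3 * ((Fintype.card V / k + 1) * (16 * Fintype.card V))) 1 (fun x y => x ≠ y) := by
  obtain ⟨f, hf1, hf2⟩ := exists_branches hG v
  have main : ∀ A ⊆ G.neighborFinset v, A.card = k →
      Sched G ((Fintype.card V / k + 1) * (16 * Fintype.card V)) 1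
        (fun x y => (x = v ∨ f x ∉ A) ∧ (y = v ∨ f y ∉ A) ∧ x ≠ y) := by
    intro A hA hAk
    have hA' : ∀ a ∈ A, G.Adj v a := fun a ha => by simpa using hA ha
    have hT := RTree.of_branches hf2 (G.neighborFinset v \ A) (by simp +contextual)
    have hmem : ∀ x, (x = v ∨ f x ∉ A) → x ∈ insert v (Finset.univ.filter fun u => u ≠ v ∧
        f u ∈ G.neighborFinset v \ A) := by
      intro x hx
      by_cases hxv : x = v
      · simp [hxv]
      · simp [hxv, hf1 x hxv, hx.resolve_left hxv]
    rw [← hAk]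
    refine (hT.sched_of_leaves hA' ?_ (by omega)).mono le_rfl
      fun x y h => ⟨hmem x h.1, hmem y h.2.1, h.2.2⟩
    rw [Finset.disjoint_right]
    intro a ha hat
    have hfa : f a = a := by
      have := (hf2 a (hA' a ha)).root_mem
      simp only [Finset.mem_filter] at this
      exact this.2.2
    simp only [Finset.mem_insert, Finset.mem_filter, Finset.mem_univ, true_and, Finset.mem_sdiff,
      hfa] at hat
    rcases hat with h | h
    · exact (hA' a ha).ne h.symm
    · exact h.2.2 ha
  rw [← SimpleGraph.card_neighborFinset_eq_degree] at hdeg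
  -- Three disjoint sets are enough: each of `f x` and `f y` lies in at most one of them, so some
  -- set avoids both.
  obtain ⟨A₁, h1, c1⟩ := Finset.exists_subset_card_eq (show k ≤ (G.neighborFinset v).card by omega)
  have hc1 := Finset.card_sdiff_of_subset h1
  obtain ⟨A₂, h2, c2⟩ := Finset.exists_subset_card_eq
    (show k ≤ (G.neighborFinset v \ A₁).card by omega)
  have hc2 := Finset.card_sdiff_of_subset h2
  obtain ⟨A₃, h3, c3⟩ := Finset.exists_subset_card_eq
    (show k ≤ ((G.neighborFinset v \ A₁) \ A₂).card by omega)
  have s2 : A₂ ⊆ G.neighborFinset v := h2.trans Finset.sdiff_subset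
  have s3 : A₃ ⊆ G.neighborFinset v := h3.trans (Finset.sdiff_subset.trans Finset.sdiff_subset)
  have d12 : ∀ x ∈ A₁, x ∉ A₂ := fun x hx hx' => (Finset.mem_sdiff.1 (h2 hx')).2 hx
  have d23 : ∀ x ∈ A₂, x ∉ A₃ := fun x hx hx' => (Finset.mem_sdiff.1 (h3 hx')).2 hx
  have d13 : ∀ x ∈ A₁, x ∉ A₃ := fun x hx hx' =>
    (Finset.mem_sdiff.1 (Finset.mem_sdiff.1 (h3 hx')).1).2 hx
  refine (((main A₁ h1 c1).comp (main A₂ s2 c2)).comp (main A₃ s3 c3)).mono (by omega) ?_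
  intro x y hxy
  simp only [mul_one, Equiv.Perm.coe_one, id]
  grind

end Star

/-! ### Orderings of the vertices with short, rarely overlapping connections -/

section Links

variable {V : Type*} {G : SimpleGraph V}

/-- `b` and `c` are adjacent, `a` is equal or adjacent to `b`, and `d` is equal or adjacent
to `c`. -/
structure Link (G : SimpleGraph V) (a b c d : V) : Prop where
  adj : G.Adj b c
  left : a = b ∨ G.Adj a b
  right : c = d ∨ G.Adj c d
  ac : a ≠ c
  ad : a ≠ d
  bd : b ≠ d

theorem Link.symm {a b c d : V} (h : Link G a b c d) : Link G d c b a :=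
  ⟨h.adj.symm, h.right.imp Eq.symm fun h => h.symm, h.left.imp Eq.symm fun h => h.symm,
    h.bd.symm, h.ad.symm, h.ac.symm⟩

/-- A sequence of vertices in which consecutive ones are linked via the given pairs. -/
inductive Trail (G : SimpleGraph V) : List V → List (V × V) → Prop
  | single (x : V) : Trail G [x] []
  | cons {a b c d : V} {xs : List V} {ls : List (V × V)} : Link G a b c d →
      Trail G (d :: xs) ls → Trail G (a :: d :: xs) ((b, c) :: ls)

theorem Trail.append {xs ys : List V} {l m : List (V × V)} {a b c d : V}
    (h₁ : Trail G (xs ++ [a]) l) (h : Link G a b c d) (h₂ : Trail G (d :: ys) m) :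
    Trail G (xs ++ [a] ++ d :: ys) (l ++ (b, c) :: m) := by
  induction xs generalizing l with
  | nil => cases h₁; exact Trail.cons h h₂
  | cons x xs ih =>
    cases xs with
    | nil =>
      cases h₁ with
      | cons h' h₁ => exact Trail.cons h' (ih h₁)
    | cons y xs =>
      cases h₁ with
      | cons h' h₁ => exact Trail.cons h' (ih h₁)

theorem Trail.reverse {xs : List V} {l : List (V × V)} (h : Trail G xs l) :
    Trail G xs.reverse (l.reverse.map Prod.swap) := by
  induction h with
  | single x => exact Trail.single x
  | cons h h' ih =>
    simp only [List.reverse_cons, List.map_append, List.map_cons, List.map_nil] at ih ⊢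
    exact Trail.append ih h.symm (Trail.single _)

theorem Trail.length_eq {xs : List V} {l : List (V × V)} (h : Trail G xs l) :
    l.length + 1 = xs.length := by
  induction h with
  | single x => rfl
  | cons h h' ih => simpa using ih

theorem Trail.link {xs : List V} {l : List (V × V)} (h : Trail G xs l) {i : ℕ}
    (hi : i + 1 < xs.length) (hl : i < l.length) : Link G xs[i] l[i].1 l[i].2 xs[i + 1] := by
  induction h generalizing i with
  | single x => simp at hi
  | cons h h' ih =>
    cases i with
    | zero => exact h
    | succ i => exact ih (by simpa using hi) (by simpa using hl)

variable [DecidableEq V]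

/-- How often `z` occurs in the pairs of a list. -/
def occurrences (z : V) (l : List (V × V)) : ℕ :=
  l.countP fun p => z = p.1 ∨ z = p.2

theorem occurrences_reverse (z : V) (l : List (V × V)) :
    occurrences z (l.reverse.map Prod.swap) = occurrences z l := by
  unfold occurrences
  rw [List.countP_map, List.countP_reverse]
  refine List.countP_congr fun p _ => ?_
  simp [or_comm]

/-- The vertices of a tree can be arranged in a sequence such that consecutive ones are at distance
at most three, and such that every vertex is used at most as often as its degree permits. -/
theorem RTree.exists_trail [DecidableRel G.Adj] {S : Finset V} {v : V} (h : RTree G S v) :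
    ∃ (xs : List V) (u : V) (l : List (V × V)), (v = u ∧ xs = [u] ∨
        G.Adj v u ∧ ∃ ys, xs = v :: (ys ++ [u])) ∧
      Trail G xs l ∧ xs.Nodup ∧ (∀ x, x ∈ xs ↔ x ∈ S) ∧
      ∀ z, occurrences z l ≤ (S.filter fun w => z ∈ S ∧ G.Adj z w).card := by
  induction h with
  | single v =>
    exact ⟨[v], v, [], Or.inl ⟨rfl, rfl⟩, Trail.single v, by simp, by simp, by simp [occurrences]⟩
  | @join S₁ S₂ c v h₁ h₂ hd hadj ih₁ ih₂ =>
    obtain ⟨ys, d, m, hys, hm, hnd₁, hmem₁, hocc₁⟩ := ih₁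
    obtain ⟨xs, a, l, hxs, hl, hnd₂, hmem₂, hocc₂⟩ := ih₂
    have hne : ∀ x y, x ∈ S₂ → y ∈ S₁ → x ≠ y := fun x y hx hy hxy =>
      Finset.disjoint_left.1 hd (hxy ▸ hy) hx
    obtain ⟨xs', hxs'⟩ : ∃ xs', xs = xs' ++ [a] := by
      rcases hxs with ⟨-, h⟩ | ⟨-, zs, h⟩
      exacts [⟨[], h⟩, ⟨v :: zs, h⟩]
    obtain ⟨ys', hys'⟩ : ∃ ys', ys.reverse = d :: ys' := by
      rcases hys with ⟨-, h⟩ | ⟨-, zs, h⟩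
      exacts [⟨[], by simp [h]⟩, ⟨zs.reverse ++ [c], by simp [h]⟩]
    have hc := h₁.root_mem
    have hv := h₂.root_mem
    have ha : a ∈ S₂ := (hmem₂ a).1 (by simp [hxs'])
    have hdS : d ∈ S₁ := (hmem₁ d).1 (by rw [← List.mem_reverse, hys']; simp)
    have hlink : Link G a v c d := by
      refine ⟨hadj, ?_, ?_, hne _ _ ha hc, hne _ _ ha hdS, hne _ _ hv hdS⟩
      · exact hxs.imp (fun h => h.1.symm) fun h => h.1.symm
      · exact hys.imp (fun h => h.1) fun h => h.1
    have hrev := hm.reverse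
    rw [hys'] at hrev
    rw [hxs'] at hl
    -- The sequence of a tree starts at its root and ends at the root or next to it. Run through
    -- `S₂` from `v` to `a`, pass over the edge from `v` to `c`, and run through `S₁` backwards from
    -- `d` to `c`. The new sequence again starts at `v` and ends next to it.
    refine ⟨xs ++ ys.reverse, c, l ++ (v, c) :: m.reverse.map Prod.swap, Or.inr ⟨hadj, ?_⟩,
      ?_, ?_, ?_, ?_⟩
    · obtain ⟨us, hus⟩ : ∃ us, xs = v :: us := by
        rcases hxs with ⟨h1, h⟩ | ⟨-, zs, h⟩
        exacts [⟨[], by rw [h, h1]⟩, ⟨zs ++ [a], h⟩]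
      obtain ⟨ws, hws⟩ : ∃ ws, ys.reverse = ws ++ [c] := by
        rcases hys with ⟨h1, h⟩ | ⟨-, zs, h⟩
        exacts [⟨[], by simp [h, h1]⟩, ⟨d :: zs.reverse, by simp [h]⟩]
      exact ⟨us ++ ws, by simp [hus, hws]⟩
    · rw [hys', hxs']
      exact Trail.append hl hlink hrev
    · rw [List.nodup_append]
      refine ⟨hnd₂, List.nodup_reverse.2 hnd₁, fun x hx y hy => ?_⟩
      exact hne x y ((hmem₂ x).1 hx) ((hmem₁ y).1 (List.mem_reverse.1 hy))
    · intro x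
      rw [List.mem_append, List.mem_reverse, hmem₁, hmem₂, Finset.mem_union, or_comm]
    · intro z
      -- Only `v` and `c` gain an occurrence, and each gains the other as a neighbour inside the
      -- tree.
      have e : occurrences z (l ++ (v, c) :: m.reverse.map Prod.swap) =
          occurrences z l + (occurrences z m + if z = v ∨ z = c then 1 else 0) := by
        rw [← occurrences_reverse z m]
        simp [occurrences, List.countP_append, List.countP_cons]
      rw [e]
      have h1 := hocc₁ z
      have h2 := hocc₂ z
      by_cases hz1 : z ∈ S₁
      · have hz2 : z ∉ S₂ := fun h => hne z z h hz1 rfl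
        have hzv : z ≠ v := fun h => hz2 (h ▸ hv)
        simp only [hz2, false_and, Finset.filter_false, Finset.card_empty, Nat.le_zero] at h2
        simp only [hz1, true_and] at h1
        simp only [Finset.mem_union, hz1, true_or, true_and, hzv, false_or, h2, zero_add]
        split_ifs with h
        · subst h
          refine (Nat.add_le_add_right h1 1).trans ?_
          rw [← Finset.card_insert_of_notMem (s := S₁.filter fun w => G.Adj z w) (a := v)
            (fun h => hne v v hv (Finset.mem_filter.1 h).1 rfl)]
          refine Finset.card_le_card fun w hw => ?_
          rcases Finset.mem_insert.1 hw with rfl | hw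
          · simp [hv, hadj.symm]
          · simp only [Finset.mem_filter] at hw
            simp [hw]
        · refine h1.trans (Finset.card_le_card fun w hw => ?_)
          simp only [Finset.mem_filter] at hw
          simp [hw]
      · have hzc : z ≠ c := fun h => hz1 (h ▸ hc)
        simp only [hz1, false_and, Finset.filter_false, Finset.card_empty, Nat.le_zero] at h1
        by_cases hz2 : z ∈ S₂
        · simp only [hz2, true_and] at h2
          simp only [Finset.mem_union, hz2, or_true, true_and, hzc, or_false, h1, zero_add]
          split_ifs with h
          · subst h
            refine (Nat.add_le_add_right h2 1).trans ?_
            rw [← Finset.card_insert_of_notMem (s := S₂.filter fun w => G.Adj z w) (a := c)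
              (fun h => hne c c (Finset.mem_filter.1 h).1 hc rfl)]
            refine Finset.card_le_card fun w hw => ?_
            rcases Finset.mem_insert.1 hw with rfl | hw
            · simp [hc, hadj]
            · simp only [Finset.mem_filter] at hw
              simp [hw]
          · refine h2.trans (Finset.card_le_card fun w hw => ?_)
            simp only [Finset.mem_filter] at hw
            simp [hw]
        · have hzv : z ≠ v := fun h => hz2 (h ▸ hv)
          simp only [hz2, false_and, Finset.filter_false, Finset.card_empty, Nat.le_zero] at h2
          simp [h1, h2, hzv, hzc]

theorem List.countP_eq_card_filter {α : Type*} (l : List α) (p : α → Prop) [DecidablePred p]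
    (d : α) : l.countP (fun x => p x) = ((Finset.range l.length).filter fun i => p (l.getD i d)).card := by
  induction l using List.reverseRecOn with
  | nil => simp
  | append_singleton l x ih =>
    rw [List.countP_append, ih, List.length_append, List.length_singleton, Finset.range_add_one,
      Finset.filter_insert]
    have h1 : (l ++ [x]).getD l.length d = x := by simp
    have h2 : ((Finset.range l.length).filter fun i => p ((l ++ [x]).getD i d)) =
        (Finset.range l.length).filter fun i => p (l.getD i d) := by
      refine Finset.filter_congr fun i hi => ?_
      rw [Finset.mem_range] at hi
      rw [List.getD_append _ _ _ _ hi]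
    rw [h1, h2]
    split_ifs with h
    · rw [Finset.card_insert_of_notMem (by simp)]
      simp [h]
    · simp [h]

/-- The vertices of a connected graph form a sequence `x 0, …, x (n - 1)` in which consecutive ones
are linked in such a way that every vertex is rarely used. -/
theorem exists_linked_sequence [Fintype V] [DecidableRel G.Adj] (hG : G.Connected) :
    ∃ x b c : ℕ → V, (∀ i j, i < Fintype.card V → j < Fintype.card V → x i = x j → i = j) ∧
      (∀ v, ∃ i < Fintype.card V, x i = v) ∧
      (∀ i, i + 1 < Fintype.card V → Link G (x i) (b i) (c i) (x (i + 1))) ∧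
      ∀ z, ((Finset.range (Fintype.card V - 1)).filter fun i => z = b i ∨ z = c i).card ≤
        G.degree z := by
  obtain ⟨v⟩ := hG.nonempty
  obtain ⟨xs, -, l, -, htr, hnd, hmem, hocc⟩ := (RTree.univ hG v).exists_trail
  have hlen : xs.length = Fintype.card V := by
    rw [← List.toFinset_card_of_nodup hnd, ← Finset.card_univ]
    congr 1
    ext x
    simp [hmem]
  have hll := htr.length_eq
  refine ⟨fun i => xs.getD i v, fun i => (l.getD i (v, v)).1, fun i => (l.getD i (v, v)).2,
    ?_, ?_, ?_, ?_⟩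
  · intro i j hi hj hij
    simp only [List.getD_eq_getElem _ _ (hlen ▸ hi), List.getD_eq_getElem _ _ (hlen ▸ hj)] at hij
    exact (List.Nodup.getElem_inj_iff hnd).1 hij
  · intro w
    obtain ⟨i, hi, h⟩ := List.mem_iff_getElem.1 ((hmem w).2 (Finset.mem_univ w))
    exact ⟨i, hlen ▸ hi, by simp only [List.getD_eq_getElem _ _ hi, h]⟩
  · intro i hi
    have h1 : i + 1 < xs.length := by omega
    have h2 : i < l.length := by omega
    simp only [List.getD_eq_getElem _ _ h1, List.getD_eq_getElem _ _ h2,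
      List.getD_eq_getElem _ _ (Nat.lt_of_succ_lt h1)]
    exact htr.link h1 h2
  · intro z
    have h := hocc z
    rw [occurrences, List.countP_eq_card_filter l (fun p => z = p.1 ∨ z = p.2) (v, v)] at h
    rw [show Fintype.card V - 1 = l.length by omega]
    refine h.trans ?_
    rw [← SimpleGraph.card_neighborFinset_eq_degree]
    exact Finset.card_le_card fun w => by simp

end Links

/-! ### Simulating odd-even transposition when degrees are small -/

section OddEvenTransposition

variable {V : Type*} {G : SimpleGraph V}

theorem Sched.symm {T : ℕ} {π : Equiv.Perm V} {M : V → V → Prop} (h : Sched G T π M) :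
    Sched G T π (fun x y => M x y ∨ M y x) := by
  obtain ⟨l, h1, h2, h3, h4⟩ := h
  exact ⟨l, h1, h2, h3, fun x y h => h.elim (h4 x y) fun h => (h4 y x h).symm⟩

theorem exists_greedy_colouring {ι : Type*} (K : Finset ι) (R : ι → ι → Prop)
    [DecidableRel R] (hR : ∀ i j, R i j → R j i) {D : ℕ}
    (hD : ∀ i ∈ K, (K.filter fun j => R i j).card ≤ D) :
    ∃ col : ι → ℕ, (∀ i, col i < D + 1) ∧ ∀ i ∈ K, ∀ j ∈ K, i ≠ j → R i j → col i ≠ col j := by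
  classical
  induction K using Finset.induction_on with
  | empty => exact ⟨fun _ => 0, by simp, by simp⟩
  | insert k K hk ih =>
    obtain ⟨col, h1, h2⟩ := ih fun i hi => (Finset.card_le_card
      (Finset.filter_subset_filter _ (Finset.subset_insert k K))).trans
      (hD i (Finset.mem_insert_of_mem hi))
    have hcard : ((K.filter fun j => R k j).image col).card < (Finset.range (D + 1)).card := by
      rw [Finset.card_range, Nat.lt_succ_iff]
      exact Finset.card_image_le.trans ((Finset.card_le_card
        (Finset.filter_subset_filter _ (Finset.subset_insert k K))).trans (hD k (by simp)))
    obtain ⟨q, hq, hqn⟩ := Finset.exists_mem_notMem_of_card_lt_card hcard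
    have hfree : ∀ j ∈ K, R k j → q ≠ col j := fun j hj hkj h =>
      hqn (h ▸ Finset.mem_image_of_mem col (Finset.mem_filter.2 ⟨hj, hkj⟩))
    have hne : ∀ j ∈ K, j ≠ k := fun j hj h => hk (h ▸ hj)
    refine ⟨Function.update col k q, fun i => ?_, fun i hi j hj hij hRij => ?_⟩
    · by_cases h : i = k
      · subst h
        simpa using hq
      · rw [Function.update_of_ne h]
        exact h1 i
    · rcases Finset.mem_insert.1 hi with rfl | hi' <;> rcases Finset.mem_insert.1 hj with rfl | hj'
      · exact absurd rfl hij
      · rw [Function.update_self, Function.update_of_ne (hne j hj')]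
        exact hfree j hj' hRij
      · rw [Function.update_self, Function.update_of_ne (hne i hi')]
        exact (hfree i hi' (hR _ _ hRij)).symm
      · rw [Function.update_of_ne (hne j hj'), Function.update_of_ne (hne i hi')]
        exact h2 i hi' j hj' hij hRij

variable {ι : Type*} [DecidableEq V]

theorem exists_parallel_round (K : Finset ι) (U : ι → Finset V)
    (hU : ∀ i ∈ K, ∀ j ∈ K, i ≠ j → Disjoint (U i) (U j)) (ρ : ι → Equiv.Perm V)
    (hρ : ∀ i ∈ K, IsRound G (ρ i)) (hfix : ∀ i ∈ K, ∀ x, x ∉ U i → ρ i x = x) :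
    ∃ σ, IsRound G σ ∧ (∀ i ∈ K, ∀ x ∈ U i, σ x = ρ i x) ∧
      ∀ x, (∀ i ∈ K, x ∉ U i) → σ x = x := by
  classical
  induction K using Finset.induction_on with
  | empty => exact ⟨1, isRound_one, by simp, by simp⟩
  | insert k K hk ih =>
    obtain ⟨σ, h1, h2, h3⟩ := ih (fun i hi j hj => hU i (by simp [hi]) j (by simp [hj]))
      (fun i hi => hρ i (by simp [hi])) (fun i hi => hfix i (by simp [hi]))
    have hdisj : ∀ x ∈ U k, ∀ i ∈ K, x ∉ U i := fun x hx i hi hx' =>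
      Finset.disjoint_left.1 (hU k (by simp) i (by simp [hi]) (fun h => hk (h ▸ hi))) hx hx'
    have hk' := hfix k (by simp)
    refine ⟨ρ k * σ, (hρ k (by simp)).mul h1 fun x => ?_, fun i hi x hx => ?_, fun x hx => ?_⟩
    · by_cases hx : x ∈ U k
      · exact Or.inr (h3 x (hdisj x hx))
      · exact Or.inl (hk' x hx)
    · rcases Finset.mem_insert.1 hi with rfl | hi
      · rw [Equiv.Perm.mul_apply, h3 x (hdisj x hx)]
      · rw [Equiv.Perm.mul_apply, h2 i hi x hx]
        refine hk' _ fun h => hdisj _ h i hi ?_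
        exact apply_mem_of_fixes (hfix i (by simp [hi])) hx
    · rw [Equiv.Perm.mul_apply, h3 x fun i hi => hx i (by simp [hi])]
      exact hk' x (hx k (by simp))

/-- Along links that do not meet, the agents at the ends can change places in three rounds. -/
theorem exists_sched_swap_disjoint (K : Finset ι) {a b c d : ι → V}
    (hL : ∀ i ∈ K, Link G (a i) (b i) (c i) (d i))
    (hU : ∀ i ∈ K, ∀ j ∈ K, i ≠ j →
      Disjoint ({a i, b i, c i, d i} : Finset V) {a j, b j, c j, d j}) :
    ∃ π, Sched G 3 π (fun x y => ∃ i ∈ K, x = a i ∧ y = d i) ∧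
      (∀ i ∈ K, π (a i) = d i ∧ π (d i) = a i) ∧
      ∀ z, (∀ i ∈ K, z ≠ a i ∧ z ≠ d i) → π z = z := by
  obtain ⟨σ, s1, s2, s3⟩ := exists_parallel_round (G := G) K
    (fun i => {a i, b i, c i, d i}) hU
    (fun i => Equiv.swap (a i) (b i) * Equiv.swap (c i) (d i)) (fun i hi => by
      have h := hL i hi
      refine (isRound_swap h.left).mul (isRound_swap h.right) fun x => ?_
      by_cases h1 : x = c i
      · exact Or.inl (Equiv.swap_apply_of_ne_of_ne (h1 ▸ h.ac.symm) (h1 ▸ h.adj.ne.symm))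
      · by_cases h2 : x = d i
        · exact Or.inl (Equiv.swap_apply_of_ne_of_ne (h2 ▸ h.ad.symm) (h2 ▸ h.bd.symm))
        · exact Or.inr (Equiv.swap_apply_of_ne_of_ne h1 h2)) (fun i hi x hx => by
      simp only [Finset.mem_insert, Finset.mem_singleton, not_or] at hx
      rw [Equiv.Perm.mul_apply, Equiv.swap_apply_of_ne_of_ne hx.2.2.1 hx.2.2.2,
        Equiv.swap_apply_of_ne_of_ne hx.1 hx.2.1])
  obtain ⟨τ, t1, t2, t3⟩ := exists_parallel_round (G := G) K
    (fun i => {a i, b i, c i, d i}) hU (fun i => Equiv.swap (b i) (c i))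
    (fun i hi => isRound_swap (Or.inr (hL i hi).adj)) (fun i hi x hx => by
      simp only [Finset.mem_insert, Finset.mem_singleton, not_or] at hx
      exact Equiv.swap_apply_of_ne_of_ne hx.2.1 hx.2.2.1)
  have sa : ∀ i ∈ K, σ (a i) = b i := fun i hi => by
    rw [s2 i hi (a i) (by simp), Equiv.Perm.mul_apply,
      Equiv.swap_apply_of_ne_of_ne (hL i hi).ac (hL i hi).ad, Equiv.swap_apply_left]
  have sd : ∀ i ∈ K, σ (d i) = c i := fun i hi => by
    rw [s2 i hi (d i) (by simp), Equiv.Perm.mul_apply, Equiv.swap_apply_right,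
      Equiv.swap_apply_of_ne_of_ne (hL i hi).ac.symm (hL i hi).adj.ne.symm]
  have sb : ∀ i ∈ K, σ (b i) = a i := fun i hi => by rw [← sa i hi, s1.apply_apply]
  have sc : ∀ i ∈ K, σ (c i) = d i := fun i hi => by rw [← sd i hi, s1.apply_apply]
  have tb : ∀ i ∈ K, τ (b i) = c i := fun i hi => by
    rw [t2 i hi (b i) (by simp), Equiv.swap_apply_left]
  have tc : ∀ i ∈ K, τ (c i) = b i := fun i hi => by rw [← tb i hi, t1.apply_apply]
  have tz : ∀ z, (∀ i ∈ K, z ≠ b i ∧ z ≠ c i) → τ z = z := fun z hz => by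
    by_cases h : ∃ i ∈ K, z ∈ ({a i, b i, c i, d i} : Finset V)
    · obtain ⟨i, hi, h⟩ := h
      rw [t2 i hi z h, Equiv.swap_apply_of_ne_of_ne (hz i hi).1 (hz i hi).2]
    · exact t3 z fun i hi h' => h ⟨i, hi, h'⟩
  -- Conjugating the swap of `b` and `c` by `σ` gives the swap of `a` and `d`; agents displaced from
  -- the inner vertices are brought back by the second `σ`. After the first round the two travelling
  -- agents are on `b` and `c`, hence acquainted.
  refine ⟨σ * (τ * σ), ?_, fun i hi => ⟨?_, ?_⟩, fun z hz => ?_⟩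
  · refine (((Sched.round s1 (M := fun x y => ∃ i ∈ K, x = a i ∧ y = d i) ?_).comp
      (Sched.round t1 (M := fun _ _ => False) (by simp))).comp
      (Sched.round s1 (M := fun _ _ => False) (by simp))).mono le_rfl
      fun x y h => Or.inl (Or.inl h)
    rintro x y ⟨i, hi, rfl, rfl⟩
    rw [sa i hi, sd i hi]
    exact (hL i hi).adj
  · simp only [Equiv.Perm.mul_apply]
    rw [sa i hi, tb i hi, sc i hi]
  · simp only [Equiv.Perm.mul_apply]
    rw [sd i hi, tc i hi, sb i hi]
  · simp only [Equiv.Perm.mul_apply]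
    rw [tz (σ z) fun i hi => ⟨fun h => ?_, fun h => ?_⟩, s1.apply_apply]
    · exact (hz i hi).1 (by rw [← s1.apply_apply z, h, sb i hi])
    · exact (hz i hi).2 (by rw [← s1.apply_apply z, h, sc i hi])

/-- Colour classes are handled one after another. As different links have different ends, the
classes move disjoint sets of agents in net effect, so earlier swaps do not disturb later ones. -/
theorem exists_sched_swap_coloured (K : Finset ι) {a b c d : ι → V}
    (hL : ∀ i ∈ K, Link G (a i) (b i) (c i) (d i))
    (hne : ∀ i ∈ K, ∀ j ∈ K, i ≠ j → a i ≠ a j ∧ a i ≠ d j ∧ d i ≠ d j) {col : ι → ℕ}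
    (hcol : ∀ i ∈ K, ∀ j ∈ K, i ≠ j →
      ¬ Disjoint ({a i, b i, c i, d i} : Finset V) {a j, b j, c j, d j} → col i ≠ col j) (q : ℕ) :
    ∃ π, Sched G (3 * q) π (fun x y => ∃ i ∈ K, col i < q ∧ x = a i ∧ y = d i) ∧
      (∀ i ∈ K, col i < q → π (a i) = d i ∧ π (d i) = a i) ∧
      ∀ z, (∀ i ∈ K, col i < q → z ≠ a i ∧ z ≠ d i) → π z = z := by
  induction q with
  | zero => exact ⟨1, Sched.nil (by simp), by simp, by simp⟩
  | succ q ih =>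
    obtain ⟨π, h1, h2, h3⟩ := ih
    obtain ⟨κ, k1, k2, k3⟩ := exists_sched_swap_disjoint (G := G) (K.filter fun i => col i = q)
      (a := a) (b := b) (c := c) (d := d) (fun i hi => hL i (Finset.mem_filter.1 hi).1)
      (fun i hi j hj hij => by
        obtain ⟨hi, hi'⟩ := Finset.mem_filter.1 hi
        obtain ⟨hj, hj'⟩ := Finset.mem_filter.1 hj
        by_contra h
        exact hcol i hi j hj hij h (hi'.trans hj'.symm))
    have hK : ∀ i ∈ K, col i = q → i ∈ K.filter fun i => col i = q :=
      fun i hi h => Finset.mem_filter.2 ⟨hi, h⟩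
    have hold : ∀ i ∈ K, col i < q → ∀ j ∈ K.filter fun i => col i = q,
        (a i ≠ a j ∧ a i ≠ d j) ∧ d i ≠ a j ∧ d i ≠ d j := by
      intro i hi hiq j hj
      obtain ⟨hj, hj'⟩ := Finset.mem_filter.1 hj
      have hij : i ≠ j := by rintro rfl; omega
      obtain ⟨e1, e2, e3⟩ := hne i hi j hj hij
      exact ⟨⟨e1, e2⟩, (hne j hj i hi hij.symm).2.1.symm, e3⟩
    have hnew : ∀ i ∈ K, col i = q → π (a i) = a i ∧ π (d i) = d i := by
      intro i hi hiq
      refine ⟨h3 _ fun j hj hjq => ?_, h3 _ fun j hj hjq => ?_⟩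
      · have := hold j hj hjq i (hK i hi hiq)
        exact ⟨this.1.1.symm, this.2.1.symm⟩
      · have := hold j hj hjq i (hK i hi hiq)
        exact ⟨this.1.2.symm, this.2.2.symm⟩
    refine ⟨κ * π, (h1.comp k1).mono (by omega) ?_, fun i hi hiq => ?_, fun z hz => ?_⟩
    · rintro x y ⟨i, hi, hiq, rfl, rfl⟩
      rcases Nat.lt_succ_iff_lt_or_eq.1 hiq with h | h
      · exact Or.inl ⟨i, hi, h, rfl, rfl⟩
      · exact Or.inr ⟨i, hK i hi h, hnew i hi h⟩
    · simp only [Equiv.Perm.mul_apply]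
      rcases Nat.lt_succ_iff_lt_or_eq.1 hiq with h | h
      · rw [(h2 i hi h).1, (h2 i hi h).2]
        exact ⟨k3 _ fun j hj => (hold i hi h j hj).2, k3 _ fun j hj => (hold i hi h j hj).1⟩
      · rw [(hnew i hi h).1, (hnew i hi h).2]
        exact k2 i (hK i hi h)
    · rw [Equiv.Perm.mul_apply, h3 z fun i hi h => hz i hi (by omega)]
      refine k3 z fun i hi => ?_
      obtain ⟨hi, hi'⟩ := Finset.mem_filter.1 hi
      exact hz i hi (by omega)

/-- The move of the index `i` in round `t` of odd-even transposition on `n` indices. -/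
def transpose (n t i : ℕ) : ℕ :=
  if (i + t) % 2 = 0 then (if i + 1 < n then i + 1 else i) else i - 1

/-- The index reached from `i` after `t` rounds of odd-even transposition. -/
def trajectory (n : ℕ) : ℕ → ℕ → ℕ
  | 0, i => i
  | t + 1, i => transpose n t (trajectory n t i)

theorem trajectory_lt {n i : ℕ} (hi : i < n) (t : ℕ) : trajectory n t i < n := by
  induction t with
  | zero => exact hi
  | succ t ih =>
    simp only [trajectory, transpose]
    split_ifs <;> omega

/-- A cyclic coordinate in which odd-even transposition is a rotation. -/
def cyclicCode (n t i : ℕ) : ℕ :=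
  if (if i % 2 = 0 then i else 2 * n - 1 - i) + t < 2 * n then
    (if i % 2 = 0 then i else 2 * n - 1 - i) + t
  else (if i % 2 = 0 then i else 2 * n - 1 - i) + t - 2 * n

/-- Unfold the path to a cycle of length `2 * n`: a code below `n` is a right-moving index, a code
`k` from `n` on is the left-moving index `2 * n - 1 - k`. Every round adds one to each code, and
waiting at an end of the path is the passage from one half to the other. -/
theorem trajectory_eq {n i t : ℕ} (hi : i < n) (ht : t ≤ n) :
    trajectory n t i =
      if cyclicCode n t i < n then cyclicCode n t i else 2 * n - 1 - cyclicCode n t i := by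
  induction t with
  | zero =>
    simp only [trajectory, cyclicCode]
    split_ifs <;> omega
  | succ t ih =>
    rw [trajectory, ih (by omega)]
    simp only [transpose, cyclicCode]
    split_ifs <;> omega

/-- All initial codes are even, say `2 * p` and `2 * q`. Two indices are about to be exchanged when
their codes add up to `-2` modulo `2 * n`, that is when `p + q + t + 1` is divisible by `n`; some `t
< n` achieves this. -/
theorem exists_trajectory_meet {n i j : ℕ} (hi : i < n) (hj : j < n) (hij : i ≠ j) :
    ∃ t < n, (trajectory n t j = trajectory n t i + 1 ∧ (trajectory n t i + t) % 2 = 0) ∨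
      (trajectory n t i = trajectory n t j + 1 ∧ (trajectory n t j + t) % 2 = 0) := by
  obtain ⟨p, hp⟩ : ∃ p, (if i % 2 = 0 then i else 2 * n - 1 - i) = 2 * p :=
    ⟨(if i % 2 = 0 then i else 2 * n - 1 - i) / 2, by split_ifs <;> omega⟩
  obtain ⟨q, hq⟩ : ∃ q, (if j % 2 = 0 then j else 2 * n - 1 - j) = 2 * q :=
    ⟨(if j % 2 = 0 then j else 2 * n - 1 - j) / 2, by split_ifs <;> omega⟩
  have hpn : p < n := by split_ifs at hp <;> omega
  have hqn : q < n := by split_ifs at hq <;> omega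
  have hpq : p ≠ q := by
    split_ifs at hp hq <;> omega
  obtain ⟨t, htn, ht⟩ : ∃ t < n, p + q + t + 1 = n ∨ p + q + t + 1 = 2 * n := by
    by_cases h : p + q + 1 ≤ n
    · exact ⟨n - 1 - p - q, by omega, by omega⟩
    · exact ⟨2 * n - 1 - p - q, by omega, by omega⟩
  refine ⟨t, htn, ?_⟩
  rw [trajectory_eq hi htn.le, trajectory_eq hj htn.le]
  simp only [cyclicCode, hp, hq]
  clear hp hq
  split_ifs <;> omega

/-- Links sharing a vertex get different colours. A link has at most four vertices, each in at most
`Δ + 2` active links, so greedy colouring needs `4 * (Δ + 2) + 1` colours, and each colour costs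
three rounds. -/
theorem exists_sched_transpose [Fintype V] [DecidableRel G.Adj] {x b c : ℕ → V}
    (hinj : ∀ i j, i < Fintype.card V → j < Fintype.card V → x i = x j → i = j)
    (hL : ∀ i, i + 1 < Fintype.card V → Link G (x i) (b i) (c i) (x (i + 1))) {Δ : ℕ}
    (hocc : ∀ z, ((Finset.range (Fintype.card V - 1)).filter fun i => z = b i ∨ z = c i).card ≤ Δ)
    (t : ℕ) :
    ∃ π, Sched G (3 * (4 * (Δ + 2) + 1)) π (fun y z => ∃ i, i + 1 < Fintype.card V ∧
        (i + t) % 2 = 0 ∧ y = x i ∧ z = x (i + 1)) ∧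
      ∀ i < Fintype.card V, π (x i) = x (transpose (Fintype.card V) t i) := by
  set n := Fintype.card V
  set K := (Finset.range (n - 1)).filter fun i => (i + t) % 2 = 0 with hKdef
  have hK : ∀ i, i ∈ K ↔ i + 1 < n ∧ (i + t) % 2 = 0 := by
    intro i
    rw [hKdef, Finset.mem_filter, Finset.mem_range]
    omega
  let U : ℕ → Finset V := fun i => {x i, b i, c i, x (i + 1)}
  -- Besides at most `Δ` links with `z` as an inner vertex there are at most one with `z` as left
  -- end and one with `z` as right end.
  have hz : ∀ z, (K.filter fun j => z ∈ U j).card ≤ Δ + 2 := by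
    intro z
    have hsub : K.filter (fun j => z ∈ U j) ⊆
        ((Finset.range (n - 1)).filter fun i => z = b i ∨ z = c i) ∪
          (K.filter (fun j => z = x j) ∪ K.filter fun j => z = x (j + 1)) := by
      intro j hj
      obtain ⟨hj, hj'⟩ := Finset.mem_filter.1 hj
      have hr : j ∈ Finset.range (n - 1) := (Finset.mem_filter.1 hj).1
      simp only [U, Finset.mem_insert, Finset.mem_singleton] at hj'
      simp only [Finset.mem_union, Finset.mem_filter, hj, hr, true_and]
      tauto
    have h1 : (K.filter fun j => z = x j).card ≤ 1 := by
      rw [Finset.card_le_one]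
      intro i hi j hj
      obtain ⟨hi, hi'⟩ := Finset.mem_filter.1 hi
      obtain ⟨hj, hj'⟩ := Finset.mem_filter.1 hj
      rw [hK] at hi hj
      exact hinj i j (by omega) (by omega) (hi'.symm.trans hj')
    have h2 : (K.filter fun j => z = x (j + 1)).card ≤ 1 := by
      rw [Finset.card_le_one]
      intro i hi j hj
      obtain ⟨hi, hi'⟩ := Finset.mem_filter.1 hi
      obtain ⟨hj, hj'⟩ := Finset.mem_filter.1 hj
      rw [hK] at hi hj
      have := hinj (i + 1) (j + 1) (by omega) (by omega) (hi'.symm.trans hj')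
      omega
    have h3 := Finset.card_le_card hsub
    have h4 := Finset.card_union_le ((Finset.range (n - 1)).filter fun i => z = b i ∨ z = c i)
      (K.filter (fun j => z = x j) ∪ K.filter fun j => z = x (j + 1))
    have h5 := Finset.card_union_le (K.filter (fun j => z = x j)) (K.filter fun j => z = x (j + 1))
    have h6 := hocc z
    omega
  obtain ⟨col, hcol1, hcol2⟩ := exists_greedy_colouring K (fun i j => ¬ Disjoint (U i) (U j))
    (fun i j h h' => h h'.symm) (D := 4 * (Δ + 2)) (by
      intro i _
      have hsub : K.filter (fun j => ¬ Disjoint (U i) (U j)) ⊆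
          (U i).biUnion fun z => K.filter fun j => z ∈ U j := by
        intro j hj
        obtain ⟨hj, hj'⟩ := Finset.mem_filter.1 hj
        obtain ⟨z, hz1, hz2⟩ := Finset.not_disjoint_iff.1 hj'
        exact Finset.mem_biUnion.2 ⟨z, hz1, Finset.mem_filter.2 ⟨hj, hz2⟩⟩
      refine (Finset.card_le_card hsub).trans ((Finset.card_biUnion_le_card_mul _ _ _
        fun z _ => hz z).trans ?_)
      exact Nat.mul_le_mul_right _ Finset.card_le_four)
  obtain ⟨π, h1, h2, h3⟩ := exists_sched_swap_coloured (G := G) K (a := x) (b := b) (c := c)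
    (d := fun i => x (i + 1)) (fun i hi => hL i ((hK i).1 hi).1) (fun i hi j hj hij => by
      rw [hK] at hi hj
      refine ⟨fun h => hij (hinj _ _ (by omega) (by omega) h), fun h => ?_, fun h => ?_⟩
      · have := hinj i (j + 1) (by omega) (by omega) h
        omega
      · have := hinj (i + 1) (j + 1) (by omega) (by omega) h
        omega) hcol2 (4 * (Δ + 2) + 1)
  refine ⟨π, h1.mono le_rfl ?_, fun i hi => ?_⟩
  · rintro y z ⟨i, hi, hit, rfl, rfl⟩
    exact ⟨i, (hK i).2 ⟨hi, hit⟩, hcol1 i, rfl, rfl⟩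
  · by_cases hright : (i + t) % 2 = 0 ∧ i + 1 < n
    · rw [transpose, if_pos hright.1, if_pos hright.2]
      exact (h2 i ((hK i).2 ⟨hright.2, hright.1⟩) (hcol1 i)).1
    · by_cases hleft : (i + t) % 2 = 1 ∧ 0 < i
      · obtain ⟨j, rfl⟩ : ∃ j, i = j + 1 := ⟨i - 1, by omega⟩
        rw [transpose, if_neg (by omega)]
        exact (h2 j ((hK j).2 ⟨hi, by omega⟩) (hcol1 j)).2
      · have : transpose n t i = i := by
          rw [transpose]
          split_ifs <;> omega
        rw [this]
        refine h3 _ fun j hj _ => ?_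
        rw [hK] at hj
        refine ⟨fun h => ?_, fun h => ?_⟩
        · have := hinj i j hi (by omega) h
          omega
        · have := hinj i (j + 1) hi (by omega) h
          omega

/-- Small degrees give a fast strategy. -/
theorem sched_of_small_degree [Fintype V] [DecidableRel G.Adj] (hG : G.Connected) {Δ : ℕ}
    (hΔ : ∀ v, G.degree v ≤ Δ) :
    ∃ π, Sched G (Fintype.card V * (3 * (4 * (Δ + 2) + 1))) π (fun x y => x ≠ y) := by
  obtain ⟨x, b, c, hinj, hsurj, hL, hocc⟩ := exists_linked_sequence hG
  set n := Fintype.card V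
  have key : ∀ t, ∃ π, Sched G (t * (3 * (4 * (Δ + 2) + 1))) π (fun y z => ∃ i j, i < n ∧ j < n ∧
      y = x i ∧ z = x j ∧ ∃ s < t, trajectory n s j = trajectory n s i + 1 ∧
        (trajectory n s i + s) % 2 = 0) ∧ ∀ i < n, π (x i) = x (trajectory n t i) := by
    intro t
    induction t with
    | zero => exact ⟨1, (Sched.nil (by simp)).mono (by simp) fun _ _ h => h, fun i _ => rfl⟩
    | succ t ih =>
      obtain ⟨π, h1, h2⟩ := ih
      obtain ⟨κ, k1, k2⟩ := exists_sched_transpose (G := G) hinj hL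
        (fun z => (hocc z).trans (hΔ z)) t
      refine ⟨κ * π, (h1.comp k1).mono (Nat.succ_mul _ _).ge ?_, fun i hi => ?_⟩
      · rintro y z ⟨i, j, hi, hj, rfl, rfl, s, hs, hs1, hs2⟩
        by_cases hst : s < t
        · exact Or.inl ⟨i, j, hi, hj, rfl, rfl, s, hst, hs1, hs2⟩
        · obtain rfl : s = t := by omega
          refine Or.inr ⟨trajectory n s i, ?_, hs2, h2 i hi, by rw [h2 j hj, hs1]⟩
          rw [← hs1]
          exact trajectory_lt hj s
      · rw [Equiv.Perm.mul_apply, h2 i hi, k2 _ (trajectory_lt hi t)]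
        rfl
  obtain ⟨π, h1, -⟩ := key n
  refine ⟨π, h1.symm.mono le_rfl fun y z hyz => ?_⟩
  obtain ⟨i, hi, rfl⟩ := hsurj y
  obtain ⟨j, hj, rfl⟩ := hsurj z
  obtain ⟨t, ht, h | h⟩ := exists_trajectory_meet hi hj fun h => hyz (by rw [h])
  · exact Or.inl ⟨i, j, hi, hj, rfl, rfl, t, ht, h⟩
  · exact Or.inr ⟨j, i, hj, hi, rfl, rfl, t, ht, h⟩

end OddEvenTransposition

/-! ### The lower bound: cliques attached to a hub -/

section LowerBound

/-- Blocks of `r` consecutive vertices form cliques, and the first vertex of all is joined to the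
first vertices of all blocks. -/
def windmill (n r : ℕ) : SimpleGraph (Fin n) where
  Adj u v := u ≠ v ∧ ((u : ℕ) / r = v / r ∨ ((u : ℕ) = 0 ∧ r ∣ v) ∨ ((v : ℕ) = 0 ∧ r ∣ u))
  symm := ⟨fun u v h => ⟨h.1.symm, by rcases h.2 with h | h | h <;> simp [h]⟩⟩
  loopless := ⟨fun u h => h.1 rfl⟩

theorem windmill_connected {n r : ℕ} (hn : 0 < n) : (windmill n r).Connected := by
  have h0 : ∀ v : Fin n, (windmill n r).Reachable v ⟨0, hn⟩ := by
    intro v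
    let w : Fin n := ⟨r * (v / r), (Nat.mul_div_le _ _).trans_lt v.2⟩
    have h1 : (windmill n r).Reachable v w := by
      by_cases h : v = w
      · rw [← h]
      · refine SimpleGraph.Adj.reachable ⟨h, Or.inl ?_⟩
        rcases Nat.eq_zero_or_pos r with rfl | hr
        · simp
        · simp [w, Nat.mul_div_cancel_left _ hr]
    have h2 : (windmill n r).Reachable w ⟨0, hn⟩ := by
      by_cases h : w = ⟨0, hn⟩
      · rw [h]
      · exact SimpleGraph.Adj.reachable ⟨h, Or.inr (Or.inr ⟨rfl, dvd_mul_right _ _⟩)⟩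
    exact h1.trans h2
  have : Nonempty (Fin n) := ⟨⟨0, hn⟩⟩
  exact ⟨fun u v => (h0 u).trans (h0 v).symm⟩

variable {n r : ℕ}

theorem card_block_le (hr : 0 < r) (q : ℕ) :
    (Finset.univ.filter fun v : Fin n => q = (v : ℕ) / r).card ≤ r := by
  have : (Finset.Ico (q * r) (q * r + r)).card = r := by simp
  refine le_trans (Finset.card_le_card_of_injOn (fun v => (v : ℕ)) ?_
    fun v _ w _ h => Fin.ext h) this.le
  intro v hv
  simp only [Finset.coe_filter, Finset.mem_univ, true_and, Set.mem_ofPred_eq] at hv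
  have := (Nat.div_eq_iff hr).1 hv.symm
  simp only [Finset.coe_Ico, Set.mem_Ico]
  omega

theorem card_filter_dvd_le : (Finset.univ.filter fun v : Fin n => r ∣ (v : ℕ)).card ≤ n / r + 1 := by
  rcases Nat.eq_zero_or_pos r with rfl | hr
  · rw [Nat.div_zero, Finset.card_le_one]
    intro a ha b hb
    simp only [Finset.mem_filter, Finset.mem_univ, true_and, zero_dvd_iff] at ha hb
    exact Fin.ext (ha.trans hb.symm)
  rw [← Finset.card_range (n / r + 1)]
  refine Finset.card_le_card_of_injOn (fun v => (v : ℕ) / r) ?_ ?_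
  · intro v _
    simp only [Finset.coe_range, Set.mem_Iio, Nat.lt_succ_iff]
    exact Nat.div_le_div_right v.2.le
  · intro v hv w hw h
    simp only [Finset.coe_filter, Finset.mem_univ, true_and, Set.mem_ofPred_eq] at hv hw
    refine Fin.ext ?_
    rw [← Nat.div_mul_cancel hv, ← Nat.div_mul_cancel hw]
    exact congrArg (· * r) h

/-- The pairs of vertices that consist of the hub and of a neighbour in another block. -/
def hubPairs (n r : ℕ) (o : Fin n) : Finset (Fin n × Fin n) :=
  (Finset.univ.filter fun v : Fin n => r ∣ (v : ℕ)).image (fun v => (o, v)) ∪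
    (Finset.univ.filter fun v : Fin n => r ∣ (v : ℕ)).image (fun v => (v, o))

theorem card_hubPairs_le (o : Fin n) : (hubPairs n r o).card ≤ 2 * (n / r + 1) := by
  have h := card_filter_dvd_le (n := n) (r := r)
  refine (Finset.card_union_le _ _).trans ?_
  have h1 := Finset.card_image_le (s := Finset.univ.filter fun v : Fin n => r ∣ (v : ℕ))
    (f := fun v => (o, v))
  have h2 := Finset.card_image_le (s := Finset.univ.filter fun v : Fin n => r ∣ (v : ℕ))
    (f := fun v => (v, o))
  omega

/-- The pairs of vertices in the same block one of which is `w`. -/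
def blockPairs (n r : ℕ) (w : Fin n) : Finset (Fin n × Fin n) :=
  (Finset.univ.filter fun v : Fin n => (w : ℕ) / r = (v : ℕ) / r).image (fun v => (w, v)) ∪
    (Finset.univ.filter fun v : Fin n => (w : ℕ) / r = (v : ℕ) / r).image (fun v => (v, w))

theorem card_blockPairs_le (hr : 0 < r) (w : Fin n) : (blockPairs n r w).card ≤ 2 * r := by
  have h := card_block_le (n := n) hr ((w : ℕ) / r)
  refine (Finset.card_union_le _ _).trans ?_
  have h1 := Finset.card_image_le (s := Finset.univ.filter fun v : Fin n => (w : ℕ) / r = (v : ℕ) / r)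
    (f := fun v => (w, v))
  have h2 := Finset.card_image_le (s := Finset.univ.filter fun v : Fin n => (w : ℕ) / r = (v : ℕ) / r)
    (f := fun v => (v, w))
  omega

theorem windmill_adj_mem {o u v : Fin n} (ho : (o : ℕ) = 0) (h : (windmill n r).Adj u v) :
    (u : ℕ) / r = v / r ∨ (u, v) ∈ hubPairs n r o := by
  rcases h.2 with h | ⟨h1, h2⟩ | ⟨h1, h2⟩
  · exact Or.inl h
  · obtain rfl : u = o := Fin.ext (h1.trans ho.symm)
    exact Or.inr (by simp [hubPairs, h2])
  · obtain rfl : v = o := Fin.ext (h1.trans ho.symm)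
    exact Or.inr (by simp [hubPairs, h2])

theorem card_adj_windmill_le (hr : 0 < r) (o : Fin n) (ho : (o : ℕ) = 0)
    (P : Finset (Fin n × Fin n)) (hP : ∀ p ∈ P, (windmill n r).Adj p.1 p.2) :
    P.card ≤ n * r + 2 * (n / r + 1) := by
  have hsub : P ⊆ (Finset.univ.sigma fun u : Fin n =>
      Finset.univ.filter fun v : Fin n => (u : ℕ) / r = (v : ℕ) / r).image
        (fun p => (p.1, p.2)) ∪ hubPairs n r o := by
    intro p hp
    rcases windmill_adj_mem ho (hP p hp) with h | h
    · refine Finset.mem_union_left _ (Finset.mem_image.2 ⟨⟨p.1, p.2⟩, by simp [h], rfl⟩)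
    · exact Finset.mem_union_right _ h
  refine (Finset.card_le_card hsub).trans ((Finset.card_union_le _ _).trans ?_)
  refine Nat.add_le_add (Finset.card_image_le.trans ?_) (card_hubPairs_le o)
  rw [Finset.card_sigma]
  refine (Finset.sum_le_sum (s := Finset.univ) fun (u : Fin n) _ => card_block_le hr ((u : ℕ) / r)).trans ?_
  simp

/-- A round moves agents between blocks only through the hub. -/
theorem windmill_round_new {o : Fin n} (ho : (o : ℕ) = 0) {σ : Equiv.Perm (Fin n)}
    (hσ : IsRound (windmill n r) σ) {p q : Fin n} (hpq : p ≠ q)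
    (hold : ¬ (windmill n r).Adj p q) (hnew : (windmill n r).Adj (σ p) (σ q)) :
    (σ p, σ q) ∈ hubPairs n r o ∪ (blockPairs n r o ∪ blockPairs n r (σ o)) := by
  rcases windmill_adj_mem ho hnew with h | h
  · refine Finset.mem_union_right _ ?_
    -- An agent leaving its block uses an edge at the hub `o`: it either arrives at `o`, or comes
    -- from `o` and arrives at `σ o`.
    have hblock : ∀ x : Fin n, ((σ x : Fin n) : ℕ) / r = x / r ∨ σ x = o ∨ σ x = σ o := by
      intro x
      by_cases hx : σ x = x
      · exact Or.inl (by rw [hx])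
      · rcases (((isRound_iff _ _).1 hσ).2 x hx).2 with h | h | h
        · exact Or.inl h.symm
        · exact Or.inr (Or.inr (by rw [show x = o from Fin.ext (h.1.trans ho.symm)]))
        · exact Or.inr (Or.inl (Fin.ext (h.1.trans ho.symm)))
    have hmem : ∀ w : Fin n, σ p = w ∨ σ q = w → (σ p, σ q) ∈ blockPairs n r w := by
      rintro w (rfl | rfl)
      · simp [blockPairs, h]
      · simp [blockPairs, h]
    rcases hblock p with hp | hp | hp
    · rcases hblock q with hq | hq | hq
      · exact absurd ⟨hpq, Or.inl (by rw [← hp, ← hq, h])⟩ hold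
      · exact Finset.mem_union_left _ (hmem _ (Or.inr hq))
      · exact Finset.mem_union_right _ (hmem _ (Or.inr hq))
    · exact Finset.mem_union_left _ (hmem _ (Or.inl hp))
    · exact Finset.mem_union_right _ (hmem _ (Or.inl hp))
  · exact Finset.mem_union_left _ h

theorem position_injective {V : Type*} (σ : ℕ → Equiv.Perm V) (t : ℕ) :
    Function.Injective (position σ t) := by
  induction t with
  | zero => exact fun _ _ h => h
  | succ t ih => exact fun a b h => ih ((σ t).injective h)

/-- Count ordered pairs: `n` diagonal ones, those adjacent at the start, and those gained in each
round. A gain involves a hub edge or one of the at most two agents now at `o` and `σ o`, which gives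
`2 * (n / r + 1)` and twice `2 * r`. -/
theorem windmill_strategy_bound (hr : 0 < r) (hn : 0 < n) {T : ℕ} {σ : ℕ → Equiv.Perm (Fin n)}
    (h : IsStrategy (windmill n r) T σ) :
    n * n ≤ n + (n * r + 2 * (n / r + 1)) + T * (4 * r + 2 * (n / r + 1)) := by
  classical
  let o : Fin n := ⟨0, hn⟩
  let E : ℕ → Finset (Fin n × Fin n) := fun t =>
    Finset.univ.filter fun p => ∃ s ≤ t, (windmill n r).Adj (position σ s p.1) (position σ s p.2)
  have hE : ∀ t ≤ T, (E t).card ≤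
      (n * r + 2 * (n / r + 1)) + t * (4 * r + 2 * (n / r + 1)) := by
    intro t
    induction t with
    | zero =>
      intro _
      refine (card_adj_windmill_le hr o rfl (E 0) fun p hp => ?_).trans (by omega)
      obtain ⟨s, hs, h⟩ := (Finset.mem_filter.1 hp).2
      obtain rfl : s = 0 := by omega
      exact h
    | succ t ih =>
      intro ht
      have hnew : (E (t + 1) \ E t).card ≤ 4 * r + 2 * (n / r + 1) := by
        have h1 := card_hubPairs_le (r := r) o
        have h2 := card_blockPairs_le hr o
        have h3 := card_blockPairs_le hr (σ t o)
        -- Newly acquainted pairs are counted by their positions after the round, which determine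
        -- the agents.
        refine le_trans (Finset.card_le_card_of_injOn
          (t := hubPairs n r o ∪ (blockPairs n r o ∪ blockPairs n r (σ t o)))
          (fun p => (position σ (t + 1) p.1, position σ (t + 1) p.2)) ?_ ?_) ?_
        · intro p hp
          obtain ⟨hp1, hp2⟩ := Finset.mem_sdiff.1 (Finset.mem_coe.1 hp)
          obtain ⟨s, hs, hadj⟩ := (Finset.mem_filter.1 hp1).2
          have hnot : ∀ s ≤ t, ¬ (windmill n r).Adj (position σ s p.1) (position σ s p.2) :=
            fun s hs h => hp2 (Finset.mem_filter.2 ⟨Finset.mem_univ _, s, hs, h⟩)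
          obtain rfl : s = t + 1 := by
            by_contra hne
            exact hnot s (by omega) hadj
          refine windmill_round_new rfl (h.1 t (by omega)) ?_ (hnot t le_rfl) hadj
          intro heq
          exact hadj.ne (congrArg (σ t) heq)
        · intro p _ q _ hpq
          have := Prod.ext_iff.1 hpq
          exact Prod.ext (position_injective σ _ this.1) (position_injective σ _ this.2)
        · have h4 := Finset.card_union_le (blockPairs n r o) (blockPairs n r (σ t o))
          have h5 := Finset.card_union_le (hubPairs n r o)
            (blockPairs n r o ∪ blockPairs n r (σ t o))
          omega
      have := Finset.card_le_card_sdiff_add_card (s := E (t + 1)) (t := E t)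
      have := ih (by omega)
      have := Nat.add_one_mul t (4 * r + 2 * (n / r + 1))
      omega
  have hall : (Finset.univ : Finset (Fin n × Fin n)) ⊆ Finset.univ.image (fun v => (v, v)) ∪ E T := by
    rintro ⟨a, b⟩ -
    by_cases hab : a = b
    · subst hab
      simp
    · exact Finset.mem_union_right _ (Finset.mem_filter.2 ⟨Finset.mem_univ _, h.2 a b hab⟩)
  have h1 := Finset.card_le_card hall
  have h2 := Finset.card_union_le (Finset.univ.image (fun v : Fin n => (v, v))) (E T)
  have h3 := Finset.card_image_le (s := (Finset.univ : Finset (Fin n))) (f := fun v => (v, v))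
  have h4 := hE T le_rfl
  simp only [Finset.card_univ, Fintype.card_prod, Fintype.card_fin] at h1 h3
  omega

theorem rpow_three_halves {n : ℕ} : (n : ℝ) ^ (3 / 2 : ℝ) = n * Real.sqrt n := by
  rcases Nat.eq_zero_or_pos n with rfl | hn
  · norm_num
  · rw [Real.sqrt_eq_rpow, show (3 / 2 : ℝ) = 1 + 1 / 2 by norm_num,
      Real.rpow_add (by exact_mod_cast hn), Real.rpow_one]

theorem windmill_strategy_lower_bound (hn : 100 ≤ n) {T : ℕ}
    {σ : ℕ → Equiv.Perm (Fin n)} (h : IsStrategy (windmill n n.sqrt) T σ) :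
    (1 / 40 : ℝ) * (n : ℝ) ^ (3 / 2 : ℝ) ≤ T := by
  have hr : 10 ≤ n.sqrt := by
    rw [Nat.le_sqrt]
    omega
  -- This follows from `n < (r + 1) ^ 2 ≤ r * (r + 3)` for `r = n.sqrt`.
  have hdiv : n / n.sqrt ≤ n.sqrt + 2 := by
    rw [← Nat.lt_succ_iff, Nat.div_lt_iff_lt_mul (by omega)]
    nlinarith [Nat.lt_succ_sqrt n]
  have hb := windmill_strategy_bound (by omega) (by omega) h
  have hsq := Nat.sqrt_le n
  clear h
  generalize n.sqrt = r at *
  have h1 : n * n ≤ n + (n * r + 2 * (r + 3)) + T * (4 * r + 2 * (r + 3)) := by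
    have := Nat.mul_le_mul_left T (show 4 * r + 2 * (n / r + 1) ≤ 4 * r + 2 * (r + 3) by omega)
    omega
  -- As `r ≥ 10` and `r * r ≤ n`, the terms without `T` amount to at most half of `n * n`, and `T *
  -- (6 * r + 6) ≤ 14 * (T * r)` with room to spare.
  have h2 : n * n ≤ 14 * (T * r) * 2 := by
    have : T * 10 ≤ T * r := Nat.mul_le_mul_left _ hr
    nlinarith
  have hs : (r : ℝ) ≤ Real.sqrt n := by
    rw [Real.le_sqrt (by positivity) (by positivity)]
    rw [sq]
    exact_mod_cast hsq
  have h3 : (n : ℝ) * n ≤ 28 * (T * Real.sqrt n) := by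
    have : ((n * n : ℕ) : ℝ) ≤ ((14 * (T * r) * 2 : ℕ) : ℝ) := by exact_mod_cast h2
    push_cast at this
    have h4 : (T : ℝ) * r ≤ T * Real.sqrt n := by gcongr
    linarith
  have hpos : 0 < Real.sqrt n := Real.sqrt_pos.2 (by exact_mod_cast (by omega : 0 < n))
  rw [rpow_three_halves]
  have h5 : Real.sqrt n * Real.sqrt n = n := Real.mul_self_sqrt (by positivity)
  have h6 : (n : ℝ) * Real.sqrt n ≤ 28 * T := by
    refine le_of_mul_le_mul_right ?_ hpos
    calc (n : ℝ) * Real.sqrt n * Real.sqrt n = n * n := by rw [mul_assoc, h5]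
      _ ≤ 28 * (T * Real.sqrt n) := h3
      _ = 28 * T * Real.sqrt n := by ring
  have h7 : (0 : ℝ) ≤ T := by positivity
  linarith

end LowerBound

/-! ### Balancing the two strategies -/

theorem exists_strategy_le {V : Type*} [Fintype V] {G : SimpleGraph V} (hG : G.Connected) :
    ∃ T ≤ 336 * (Fintype.card V * (Fintype.card V).sqrt), ∃ σ, IsStrategy G T σ := by
  classical
  obtain ⟨v₀⟩ := hG.nonempty
  have hpos : 0 < Fintype.card V := Fintype.card_pos_iff.2 ⟨v₀⟩
  set n := Fintype.card V with hn
  have hr : 0 < n.sqrt := Nat.sqrt_pos.2 hpos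
  have hlt := Nat.lt_succ_sqrt n
  generalize n.sqrt = r at *
  suffices h : ∃ T ≤ 336 * (n * r), ∃ π, Sched G T π fun x y => x ≠ y by
    obtain ⟨T, hT, π, h⟩ := h
    obtain ⟨T', hT', h⟩ := h.exists_isStrategy
    exact ⟨T', hT'.trans hT, h⟩
  -- The threshold lies between `r + 1` and `r + 3`. Above it, `k = r / 3 + 1` gives `n / k ≤ 3 * (r
  -- + 1)` and the constant `3 * 7 * 16 = 336`; below it, `Δ = r + 3` stays well within the same
  -- constant.
  by_cases hdeg : ∃ v, 3 * (r / 3 + 1) ≤ G.degree v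
  · obtain ⟨v, hv⟩ := hdeg
    refine ⟨_, ?_, 1, sched_of_large_degree hG v (Nat.succ_pos _) hv⟩
    rw [← hn]
    have hdiv : n / (r / 3 + 1) ≤ 3 * (r + 1) := by
      refine Nat.div_le_of_le_mul ?_
      have h1 : r + 1 ≤ 3 * (r / 3 + 1) := by omega
      have h2 := Nat.mul_le_mul_right (r + 1) h1
      simp only [Nat.succ_eq_add_one] at hlt
      calc n ≤ 3 * (r / 3 + 1) * (r + 1) := by omega
        _ = (r / 3 + 1) * (3 * (r + 1)) := by ring
    calc 3 * ((n / (r / 3 + 1) + 1) * (16 * n)) ≤ 3 * ((3 * (r + 1) + 1) * (16 * n)) := by gcongr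
      _ ≤ 3 * ((7 * r) * (16 * n)) := by gcongr; omega
      _ = 336 * (n * r) := by ring
  · push Not at hdeg
    obtain ⟨π, h⟩ := sched_of_small_degree hG (Δ := r + 3) fun v => by
      have := hdeg v
      omega
    refine ⟨_, ?_, π, h⟩
    rw [← hn]
    calc n * (3 * (4 * (r + 3 + 2) + 1)) ≤ n * (336 * r) := Nat.mul_le_mul_left _ (by omega)
      _ = 336 * (n * r) := by ring

theorem acquaintanceTime_le {V : Type*} [Fintype V] {G : SimpleGraph V} (hG : G.Connected) :
    ∃ m : ℕ, acquaintanceTime G = m ∧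
      (m : ℝ) ≤ 336 * (Fintype.card V : ℝ) ^ (3 / 2 : ℝ) := by
  obtain ⟨T, hT, h⟩ := exists_strategy_le hG
  obtain ⟨m, hm, h, -⟩ := exists_acquaintanceTime_eq h
  refine ⟨m, h, ?_⟩
  have h1 : (m : ℝ) ≤ ((336 * (Fintype.card V * (Fintype.card V).sqrt) : ℕ) : ℝ) := by
    exact_mod_cast hm.trans hT
  push_cast at h1
  rw [rpow_three_halves]
  refine h1.trans ?_
  gcongr
  exact Real.nat_sqrt_le_real_sqrt

end Acquaintance

theorem mainTheorem2 :
    (∃ C : ℝ, ∀ (V : Type*) [Fintype V] (G : SimpleGraph V), G.Connected →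
      ∃ m : ℕ, Acquaintance.acquaintanceTime G = m ∧
        (m : ℝ) ≤ C * (Fintype.card V : ℝ) ^ (3 / 2 : ℝ)) ∧
    (∃ c : ℝ, 0 < c ∧ ∃ n₀ : ℕ, ∀ n : ℕ, n₀ ≤ n →
      ∃ G : SimpleGraph (Fin n), G.Connected ∧
        ∃ m : ℕ, Acquaintance.acquaintanceTime G = m ∧
          c * (n : ℝ) ^ (3 / 2 : ℝ) ≤ (m : ℝ)) := by
  refine ⟨⟨336, fun V _ G hG => Acquaintance.acquaintanceTime_le hG⟩,
    1 / 40, by norm_num, 100, fun n hn => ?_⟩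
  have hconn := Acquaintance.windmill_connected (n := n) (r := n.sqrt) (by omega)
  -- The upper bound ensures that the acquaintance time is finite, so that an optimal strategy
  -- exists to which the lower bound applies.
  obtain ⟨T, -, h⟩ := Acquaintance.exists_strategy_le hconn
  obtain ⟨m, -, h, σ, hσ⟩ := Acquaintance.exists_acquaintanceTime_eq h
  exact ⟨_, hconn, m, h, Acquaintance.windmill_strategy_lower_bound hn hσ⟩
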